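/- An $r$-graph is a finite hypergraph all of whose edges have size $r$. The minimum positive co-degree $\delta^+_{r-1}(H)$ of an $r$-graph $H$ with at least one edge is the largest integer $k$ such that every $(r-1)$-set of vertices contained in some edge of $H$ is contained in at least $k$ edges of $H$; it is $0$ if $H$ has no edge. For a (possibly infinite) family $\mathcal F$ of $r$-graphs, let $\mathrm{co^+ex}(n,\mathcal F)$ be the maximum of $\delta^+_{r-1}(H)$ over all $n$-vertex $r$-graphs $H$ containing no member of $\mathcal F$ as a (not necessarily induced) subhypergraph (read as $0$ if there is no such $H$), and let $\gamma^+(\mathcal F)=\lim_{n\to\infty}\mathrm{co^+ex}(n,\mathcal F)/n$. A number $\alpha\in[0,1)$ is a $\gamma^+$-jump (for $r$-graphs) if there is $\delta\in(0,1-\alpha)$ such that no family $\mathcal F$ of $r$-graphs satisfies $\gamma^+(\mathcal F)\in(\alpha,\alpha+\delta)$. An $r$-graph is $r$-partite if its vertex set can be partitioned into $r$ (possibly empty) classes such that each edge meets each class at most once. The $t$-blow-up of an $r$-graph $H$ is obtained by replacing each vertex of $H$ by a class of $t$ vertices, a set of $r$ vertices being an edge if and only if its vertices lie in $r$ distinct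 classes that correspond to an edge of $H$. An $r$-triangle $T^r$ is an $r$-graph with $r+1$ vertices and exactly three edges (it is unique up to isomorphism). **Theorem.** Let $r\ge 2$. For every family $\mathcal F$ of $r$-graphs the limit $\gamma^+(\mathcal F)$ exists and $$\gamma^+(\mathcal F)\in\left\{0,\tfrac1r\right\}\cup\left[\tfrac{2}{2r-1},1\right].$$ Thus every $\alpha\in\left[0,\tfrac{2}{2r-1}\right)$ is a $\gamma^+$-jump. Moreover, $\gamma^+(\mathcal F)=0$ if and only if some member of $\mathcal F$ is $r$-partite, and $\gamma^+(\mathcal F)=\tfrac1r$ if and only if no member of $\mathcal F$ is $r$-partite but some member of $\mathcal F$ is contained in a $t$-blow-up, for some $t$, of an $r$-triangle $T^r$. -/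

import Mathlib

open Filter Topology

/-- An `r`-graph on the vertex set `V`: a set of edges, each of which is an `r`-element subset
of `V`. -/
structure RGraph (r : ℕ) (V : Type*) where
  /-- the edge set -/
  edges : Finset (Finset V)
  /-- every edge has exactly `r` vertices -/
  card_eq : ∀ e ∈ edges, e.card = r

namespace RGraph

variable {r : ℕ} {V W : Type*}

/-- `F.IsContainedIn H`: `H` has a (not necessarily induced) subhypergraph isomorphic to `F`,
that is, there is an injection of the vertices of `F` into those of `H` which maps edges to
edges. -/
def IsContainedIn (F : RGraph r V) (H : RGraph r W) : Prop :=
  ∃ f : V ↪ W, ∀ e ∈ F.edges, e.map f ∈ H.edges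

/-- The co-degree of a vertex set `S`: the number of edges that contain `S`. -/
def codegree [DecidableEq V] (H : RGraph r V) (S : Finset V) : ℕ :=
  (H.edges.filter (fun e => S ⊆ e)).card

/-- The minimum positive co-degree `δ⁺_{r-1}(H)`: zero if `H` has no edge, and otherwise the
largest `k` such that every `(r-1)`-set of vertices which is contained in some edge is contained
in at least `k` edges. (For `r ≥ 1` and `H` with an edge the set below is nonempty and bounded.) -/
noncomputable def minPosCodegree [DecidableEq V] (H : RGraph r V) : ℕ :=
  if H.edges = ∅ then 0
  else sSup {k : ℕ | ∀ S : Finset V, S.card = r - 1 → (∃ e ∈ H.edges, S ⊆ e) → k ≤ H.codegree S}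

/-- `H` is `k`-partite: the vertices can be split into `k` (possibly empty) classes so that each
edge meets each class at most once; `c` maps each vertex to its class. -/
def IsPartite (H : RGraph r V) (k : ℕ) : Prop :=
  ∃ c : V → Fin k, ∀ e ∈ H.edges, ∀ x ∈ e, ∀ y ∈ e, c x = c y → x = y

/-- The `t`-blow-up `H[t]`: the vertex `v` is replaced by the class `{v} × Fin t`, and a set of `r`
vertices is an edge iff the classes it meets form an edge of `H` (which has `r` vertices, so that
the `r` vertices lie in distinct classes). -/
def blowUp [Fintype V] [DecidableEq V] (H : RGraph r V) (t : ℕ) : RGraph r (V × Fin t) where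
  edges := ((Finset.univ : Finset (V × Fin t)).powersetCard r).filter
    (fun e => e.image Prod.fst ∈ H.edges)
  card_eq := fun _ he => (Finset.mem_powersetCard.mp (Finset.mem_filter.mp he).1).2

/-- An `r`-graph on `r + 1` vertices is an `r`-triangle if it has exactly three edges. -/
def IsTriangle (T : RGraph r (Fin (r + 1))) : Prop :=
  T.edges.card = 3

end RGraph

/-- A family of finite `r`-graphs, possibly infinite or empty. Every finite `r`-graph is isomorphic
to one with vertex set `Fin m` for some `m`. -/
abbrev RGraphFamily (r : ℕ) : Type := Set (Σ m : ℕ, RGraph r (Fin m))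

/-- `H` contains no member of the family. -/
def RGraphFamily.Free {r : ℕ} (𝓕 : RGraphFamily r) {V : Type*} (H : RGraph r V) : Prop :=
  ∀ F ∈ 𝓕, ¬ F.2.IsContainedIn H

/-- The positive co-degree Turán number `co⁺ex(n, 𝓕)`: the largest minimum positive co-degree of an
`n`-vertex `r`-graph that contains no member of `𝓕`. (If there is no such `r`-graph, which can only
happen when some member of `𝓕` is edgeless, the value is `0`.) -/
noncomputable def coPosEx {r : ℕ} (n : ℕ) (𝓕 : RGraphFamily r) : ℕ :=
  sSup {d : ℕ | ∃ H : RGraph r (Fin n), 𝓕.Free H ∧ H.minPosCodegree = d}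

/-- The positive co-degree density `γ⁺(𝓕)`, the limit of `co⁺ex(n, 𝓕) / n`. -/
noncomputable def posCodegreeDensity {r : ℕ} (𝓕 : RGraphFamily r) : ℝ :=
  limUnder atTop (fun n : ℕ => (coPosEx n 𝓕 : ℝ) / (n : ℝ))

/-- `α ∈ [0, 1)` is a `φ`-jump, for a function `φ` on families of `r`-graphs, if for some
`δ ∈ (0, 1 - α)` no family has its `φ`-value in the open interval `(α, α + δ)`. -/
def IsJump {r : ℕ} (φ : RGraphFamily r → ℝ) (α : ℝ) : Prop :=
  α ∈ Set.Ico (0 : ℝ) 1 ∧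
    ∃ δ ∈ Set.Ioo (0 : ℝ) (1 - α), ¬ ∃ 𝓕 : RGraphFamily r, φ 𝓕 ∈ Set.Ioo α (α + δ)

/-! Containment in some blow-up of `G` is the same as having a homomorphism to `G`, and being
`r`-partite is having one to a single edge. So the theorem compares the family with two target
graphs, the edge and the `r`-triangle.

Upper bounds rest on supersaturation: by Erdős's box theorem, a positive proportion of copies of `G`
forces a blow-up of `G`, hence every `F` that maps to `G` (`exists_isContainedIn_of_card_copies`).
Positive co-degree `d` gives at least `d ^ r` edge tuples (`HasPosCodegree.pow_le_card_copies`), so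
linear `d` already forces `r`-partite members. If `d ≥ (1/r + ε)n`, the `r` neighbourhoods of the
`(r-1)`-subsets of an edge have total size at least `(1 + rε)n`. At least `εn` vertices therefore
lie in two of them, and each such vertex spans a triangle with the edge. This gives positively many
triangles.

Lower bounds come from weighted blow-ups, which contain only graphs with a homomorphism to the base
graph. The balanced blow-up of an edge has density `1/r`. The triangle, with weight 1 on the three
vertices missed by an edge and 2 on the others, has total weight `2r - 1` and weighted positive
co-degree 2, whence `2/(2r - 1)`.

The limit exists by sampling: a Chernoff bound shows that a random set of `m` vertices almost
preserves the relative positive co-degree, so values at large `n` exceed those at large fixed `m` by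
at most a small error. -/

namespace RGraph

/-! ### Neighbourhoods, pullbacks along vertex maps, and homomorphisms -/

section Basic

variable {r : ℕ} {V W : Type*} [Fintype V] [DecidableEq V] [Fintype W] [DecidableEq W]

/-- The vertices that complete `S` to an edge. -/
def nbr (H : RGraph r V) (S : Finset V) : Finset V :=
  Finset.univ.filter (fun v => v ∉ S ∧ insert v S ∈ H.edges)

theorem mem_nbr {H : RGraph r V} {S : Finset V} {v : V} :
    v ∈ H.nbr S ↔ v ∉ S ∧ insert v S ∈ H.edges := by
  simp [nbr]

theorem codegree_eq_card_nbr (hr : 1 ≤ r) (H : RGraph r V) {S : Finset V}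
    (hS : S.card = r - 1) : H.codegree S = (H.nbr S).card := by
  symm
  unfold codegree
  refine Finset.card_bij (fun v _ => insert v S) ?_ ?_ ?_
  · intro v hv
    rw [mem_nbr] at hv
    exact Finset.mem_filter.2 ⟨hv.2, Finset.subset_insert _ _⟩
  · intro a ha b hb hab
    rw [mem_nbr] at ha hb
    have : a ∈ insert b S := hab ▸ Finset.mem_insert_self a S
    exact (Finset.mem_insert.1 this).resolve_right ha.1
  · intro e he
    rw [Finset.mem_filter] at he
    have h := H.card_eq e he.1
    obtain ⟨a, ha, rfl⟩ := Finset.exists_eq_insert_iff.2 ⟨he.2, by omega⟩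
    exact ⟨a, mem_nbr.2 ⟨ha, he.1⟩, rfl⟩

/-- `H` has an edge and its minimum positive co-degree is at least `d`. -/
def HasPosCodegree (H : RGraph r V) (d : ℕ) : Prop :=
  H.edges.Nonempty ∧
    ∀ S : Finset V, S.card = r - 1 → (∃ e ∈ H.edges, S ⊆ e) → d ≤ (H.nbr S).card

omit [Fintype V] [DecidableEq V] in
theorem exists_positive_set {H : RGraph r V} (h : H.edges.Nonempty) :
    ∃ S : Finset V, S.card = r - 1 ∧ ∃ e ∈ H.edges, S ⊆ e := by
  obtain ⟨e, he⟩ := h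
  obtain ⟨S, hS, hc⟩ := Finset.exists_subset_card_eq
    (show r - 1 ≤ e.card by rw [H.card_eq e he]; omega)
  exact ⟨S, hc, e, he, hS⟩

theorem bddAbove_posCodegree (hr : 1 ≤ r) {H : RGraph r V} (h : H.edges.Nonempty) :
    Fintype.card V ∈ upperBounds {k : ℕ | ∀ S : Finset V, S.card = r - 1 →
      (∃ e ∈ H.edges, S ⊆ e) → k ≤ H.codegree S} := by
  obtain ⟨S, hS, he⟩ := exists_positive_set h
  intro k hk
  refine (hk S hS he).trans ?_
  rw [codegree_eq_card_nbr hr H hS]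
  exact Finset.card_le_univ _

theorem HasPosCodegree.le_minPosCodegree (hr : 1 ≤ r) {H : RGraph r V} {d : ℕ}
    (h : H.HasPosCodegree d) : d ≤ H.minPosCodegree := by
  unfold minPosCodegree
  rw [if_neg h.1.ne_empty]
  refine le_csSup ⟨_, bddAbove_posCodegree hr h.1⟩ ?_
  intro S hS he
  rw [codegree_eq_card_nbr hr H hS]
  exact h.2 S hS he

theorem hasPosCodegree_minPosCodegree (hr : 1 ≤ r) {H : RGraph r V}
    (h : 0 < H.minPosCodegree) : H.HasPosCodegree H.minPosCodegree := by
  have hne : H.edges.Nonempty := by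
    by_contra hne
    simp [minPosCodegree, Finset.not_nonempty_iff_eq_empty.1 hne] at h
  refine ⟨hne, fun S hS he => ?_⟩
  have hm := Nat.sSup_mem (s := {k : ℕ | ∀ S : Finset V, S.card = r - 1 →
      (∃ e ∈ H.edges, S ⊆ e) → k ≤ H.codegree S}) ⟨0, by simp⟩
      ⟨_, bddAbove_posCodegree hr hne⟩
  rw [← codegree_eq_card_nbr hr H hS]
  unfold minPosCodegree
  rw [if_neg hne.ne_empty]
  exact hm S hS he

theorem minPosCodegree_le_card (hr : 1 ≤ r) (H : RGraph r V) :
    H.minPosCodegree ≤ Fintype.card V := by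
  rcases Nat.eq_zero_or_pos H.minPosCodegree with h | h
  · omega
  · have h' := hasPosCodegree_minPosCodegree hr h
    obtain ⟨S, hS, he⟩ := exists_positive_set h'.1
    exact (h'.2 S hS he).trans (Finset.card_le_univ _)

/-- The `r`-sets whose image under `c` is an edge of `G`. For injective `c` this is an induced
subhypergraph of `G`, in general a subhypergraph of a blow-up. -/
def comap (c : V → W) (G : RGraph r W) : RGraph r V where
  edges := (Finset.univ.powersetCard r).filter (fun e => e.image c ∈ G.edges)
  card_eq := fun _ he => (Finset.mem_powersetCard.mp (Finset.mem_filter.mp he).1).2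

omit [DecidableEq V] [Fintype W] in
theorem mem_comap_edges {c : V → W} {G : RGraph r W} {e : Finset V} :
    e ∈ (G.comap c).edges ↔ e.card = r ∧ e.image c ∈ G.edges := by
  simp [comap, Finset.mem_powersetCard]

/-- An edge of the pullback maps injectively, so only sets `S` on which `c` is injective matter. A
vertex mapped into the link of `S.image c` is automatically outside `S`, so it lies in the link of
`S`. Serves both for blow-ups and, with injective `c`, for samples. -/
theorem hasPosCodegree_comap (hr : 1 ≤ r) {c : V → W} {G : RGraph r W} {d : ℕ}
    (hne : (G.comap c).edges.Nonempty)
    (h : ∀ S : Finset V, S.card = r - 1 → (S.image c).card = r - 1 →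
      (∃ e ∈ G.edges, S.image c ⊆ e) →
      d ≤ (Finset.univ.filter (fun v => c v ∈ G.nbr (S.image c))).card) :
    (G.comap c).HasPosCodegree d := by
  refine ⟨hne, fun S hS ⟨e, he, hSe⟩ => ?_⟩
  rw [mem_comap_edges] at he
  have hinj : Set.InjOn c e := Finset.card_image_iff.1 (by rw [G.card_eq _ he.2, he.1])
  have hc : (S.image c).card = r - 1 := by
    rw [Finset.card_image_of_injOn (hinj.mono (by exact_mod_cast hSe)), hS]
  refine (h S hS hc ⟨_, he.2, Finset.image_subset_image hSe⟩).trans (Finset.card_le_card ?_)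
  intro v hv
  simp only [Finset.mem_filter, Finset.mem_univ, true_and, mem_nbr] at hv
  have hvS : v ∉ S := fun h => hv.1 (Finset.mem_image_of_mem c h)
  refine mem_nbr.2 ⟨hvS, mem_comap_edges.2 ⟨?_, ?_⟩⟩
  · rw [Finset.card_insert_of_notMem hvS]; omega
  · rw [Finset.image_insert]; exact hv.2

/-- `F` has a homomorphism to `G`: a map of the vertices that sends edges to edges. -/
def HomTo (F : RGraph r V) (G : RGraph r W) : Prop :=
  ∃ c : V → W, ∀ e ∈ F.edges, e.image c ∈ G.edges

omit [Fintype V] [DecidableEq V] [Fintype W] in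
theorem HomTo.trans {U : Type*} {F : RGraph r V} {G : RGraph r W} [DecidableEq U] {K : RGraph r U}
    (h : F.HomTo G) (h' : G.HomTo K) : F.HomTo K := by
  obtain ⟨c, hc⟩ := h
  obtain ⟨c', hc'⟩ := h'
  refine ⟨c' ∘ c, fun e he => ?_⟩
  rw [← Finset.image_image]
  exact hc' _ (hc e he)

omit [Fintype W] in
theorem homTo_of_isContainedIn_comap {U : Type*} {F : RGraph r U} {G : RGraph r W} {c : V → W}
    (h : F.IsContainedIn (G.comap c)) : F.HomTo G := by
  obtain ⟨f, hf⟩ := h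
  refine ⟨c ∘ f, fun e he => ?_⟩
  have := (mem_comap_edges.1 (hf e he)).2
  rwa [Finset.map_eq_image, Finset.image_image] at this

omit [DecidableEq V] [Fintype W] in
theorem isContainedIn_of_isContainedIn_comap {U : Type*} {F : RGraph r U} {G : RGraph r W}
    {c : V ↪ W} (h : F.IsContainedIn (G.comap c)) : F.IsContainedIn G := by
  obtain ⟨f, hf⟩ := h
  refine ⟨f.trans c, fun e he => ?_⟩
  have := (mem_comap_edges.1 (hf e he)).2
  rwa [← Finset.map_eq_image, Finset.map_map] at this

theorem homTo_of_isContainedIn_blowUp {U : Type*} {F : RGraph r U} {G : RGraph r W} {t : ℕ}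
    (h : F.IsContainedIn (G.blowUp t)) : F.HomTo G := by
  obtain ⟨f, hf⟩ := h
  refine ⟨Prod.fst ∘ f, fun e he => ?_⟩
  have := (Finset.mem_filter.1 (hf e he)).2
  rwa [Finset.map_eq_image, Finset.image_image] at this

/-- Tagging each image with the vertex itself makes any homomorphism injective; hence classes of
size `m` suffice. -/
theorem HomTo.isContainedIn_blowUp {m : ℕ} {F : RGraph r (Fin m)} {G : RGraph r W}
    (h : F.HomTo G) : F.IsContainedIn (G.blowUp m) := by
  obtain ⟨c, hc⟩ := h
  refine ⟨⟨fun v => (c v, v), fun a b hab => (Prod.ext_iff.1 hab).2⟩, fun e he => ?_⟩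
  refine Finset.mem_filter.2 ⟨Finset.mem_powersetCard.2 ⟨Finset.subset_univ _, ?_⟩, ?_⟩
  · rw [Finset.card_map, F.card_eq e he]
  · rw [Finset.map_eq_image, Finset.image_image]
    exact hc e he

omit [Fintype V] [DecidableEq V] [Fintype W] [DecidableEq W] in
theorem IsContainedIn.trans {U : Type*} {F : RGraph r U} {G : RGraph r V} {H : RGraph r W}
    (h : F.IsContainedIn G) (h' : G.IsContainedIn H) : F.IsContainedIn H := by
  obtain ⟨f, hf⟩ := h
  obtain ⟨g, hg⟩ := h'
  exact ⟨f.trans g, fun e he => by rw [← Finset.map_map]; exact hg _ (hf e he)⟩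

/-- The `r`-graph on `r` vertices with one edge. -/
def singleEdge (r : ℕ) : RGraph r (Fin r) where
  edges := {Finset.univ}
  card_eq := by simp

omit [Fintype V] [DecidableEq V] in
-- An edge has exactly `r` vertices, so a colouring is injective on it if and only if it uses all
-- `r` colours.
theorem isPartite_iff_homTo {F : RGraph r V} : F.IsPartite r ↔ F.HomTo (singleEdge r) := by
  refine exists_congr fun c => forall₂_congr fun e he => ?_
  simp only [singleEdge, Finset.mem_singleton]
  rw [← Finset.card_eq_iff_eq_univ, Fintype.card_fin]
  have : (e.image c).card = r ↔ (e.image c).card = e.card := by rw [F.card_eq e he]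
  rw [this, Finset.card_image_iff]
  exact ⟨fun h x hx y hy hxy => h x hx y hy hxy, fun h x hx y hy hxy => h hx hy hxy⟩

end Basic

end RGraph

open RGraph

/-! ### Attainment of the extremal number -/

section Extremal

variable {r n : ℕ} {𝓕 : RGraphFamily r}

theorem bddAbove_coPosEx (hr : 1 ≤ r) : n ∈ upperBounds
    {d : ℕ | ∃ H : RGraph r (Fin n), 𝓕.Free H ∧ H.minPosCodegree = d} := by
  rintro d ⟨H, -, rfl⟩
  simpa using minPosCodegree_le_card hr H

theorem coPosEx_le (hr : 1 ≤ r) : coPosEx n 𝓕 ≤ n :=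
  csSup_le' (bddAbove_coPosEx hr)

theorem le_coPosEx (hr : 1 ≤ r) {H : RGraph r (Fin n)} {d : ℕ} (hF : 𝓕.Free H)
    (h : H.HasPosCodegree d) : d ≤ coPosEx n 𝓕 :=
  (h.le_minPosCodegree hr).trans (le_csSup ⟨n, bddAbove_coPosEx hr⟩ ⟨H, hF, rfl⟩)

theorem exists_free_of_coPosEx_pos (hr : 1 ≤ r) (h : 0 < coPosEx n 𝓕) :
    ∃ H : RGraph r (Fin n), 𝓕.Free H ∧ H.HasPosCodegree (coPosEx n 𝓕) := by
  have hne : {d : ℕ | ∃ H : RGraph r (Fin n), 𝓕.Free H ∧ H.minPosCodegree = d}.Nonempty := by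
    by_contra hne
    simp [coPosEx, Set.not_nonempty_iff_eq_empty.1 hne] at h
  obtain ⟨H, hF, hH⟩ := Nat.sSup_mem hne ⟨n, bddAbove_coPosEx hr⟩
  refine ⟨H, hF, ?_⟩
  have hH' : H.minPosCodegree = coPosEx n 𝓕 := hH
  rw [← hH'] at h ⊢
  exact hasPosCodegree_minPosCodegree hr h

end Extremal

/-! ### Erdős's theorem: dense relations contain complete boxes -/

section Box

/-- The falling factorial is at least `(n - T) ^ T`, and Bernoulli's inequality bounds `(1 - T/n) ^
T` from below. -/
theorem card_injective_ge {T n : ℕ} (hn : 0 < n) (hT : T ≤ n) :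
    (1 - (T : ℝ) ^ 2 / n) * (n : ℝ) ^ T ≤
      ((Finset.univ.filter (fun f : Fin T → Fin n => Function.Injective f)).card : ℝ) := by
  have h1 : (Finset.univ.filter (fun f : Fin T → Fin n => Function.Injective f)).card
      = n.descFactorial T := by
    rw [← Fintype.card_subtype,
      Fintype.card_congr (Equiv.subtypeInjectiveEquivEmbedding (Fin T) (Fin n)),
      Fintype.card_embedding_eq, Fintype.card_fin, Fintype.card_fin]
  have hn' : (0 : ℝ) < n := by exact_mod_cast hn
  have hT' : (T : ℝ) ≤ n := by exact_mod_cast hT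
  have h2 : ((n - T : ℕ) : ℝ) ^ T ≤ (n.descFactorial T : ℝ) := by
    exact_mod_cast (Nat.pow_le_pow_left (by omega) T).trans (Nat.pow_sub_le_descFactorial n T)
  rw [h1]
  refine le_trans ?_ h2
  rw [Nat.cast_sub hT]
  have h3 : (n : ℝ) - T = (1 + -((T : ℝ) / n)) * n := by field_simp; ring
  rw [h3, mul_pow]
  refine mul_le_mul_of_nonneg_right ?_ (by positivity)
  have h4 := one_add_mul_le_pow (a := -((T : ℝ) / n))
    (by have : (T : ℝ) / n ≤ 1 := (div_le_one hn').2 hT'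
        linarith) T
  refine le_trans (le_of_eq ?_) h4
  field_simp
  ring

theorem card_not_injective_le {T n : ℕ} (hn : 0 < n) (hT : T ≤ n) :
    ((Finset.univ.filter (fun f : Fin T → Fin n => ¬ Function.Injective f)).card : ℝ) ≤
      (T : ℝ) ^ 2 / n * (n : ℝ) ^ T := by
  have h := card_injective_ge hn hT
  have h2 := Finset.card_filter_add_card_filter_not (s := Finset.univ)
    (fun f : Fin T → Fin n => Function.Injective f)
  rw [Finset.card_univ, Fintype.card_fun, Fintype.card_fin, Fintype.card_fin] at h2
  have h3 : ((Finset.univ.filter (fun f : Fin T → Fin n => Function.Injective f)).card : ℝ) +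
    ((Finset.univ.filter (fun f : Fin T → Fin n => ¬ Function.Injective f)).card : ℝ) =
      (n : ℝ) ^ T := by exact_mod_cast h2
  linarith

theorem card_eq_sum_card_cons {k n : ℕ} (R : Finset (Fin (k + 1) → Fin n)) :
    R.card = ∑ x : Fin k → Fin n,
      (Finset.univ.filter (fun v : Fin n => (Fin.cons v x : Fin (k + 1) → Fin n) ∈ R)).card := by
  rw [Finset.card_eq_sum_card_fiberwise (f := Fin.tail) (t := Finset.univ) (by simp)]
  refine Finset.sum_congr rfl fun x _ => ?_
  refine Finset.card_bij' (fun z _ => z 0) (fun v _ => Fin.cons v x) ?_ ?_ ?_ ?_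
  · intro z hz
    rw [Finset.mem_filter] at hz
    obtain ⟨hz, rfl⟩ := hz
    simpa [Fin.cons_self_tail] using hz
  · intro v hv
    simpa using hv
  · intro z hz
    rw [Finset.mem_filter] at hz
    obtain ⟨hz, rfl⟩ := hz
    simp [Fin.cons_self_tail]
  · intro v hv
    simp

theorem sum_card_common_eq {α β : Type*} [Fintype α] [Fintype β] [DecidableEq β] (P : β → α → Prop)
    [∀ b a, Decidable (P b a)] (T : ℕ) :
    ∑ y : Fin T → β, (Finset.univ.filter (fun x : α => ∀ j, P (y j) x)).card =
      ∑ x : α, (Finset.univ.filter (fun v : β => P v x)).card ^ T := by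
  simp_rw [Finset.card_filter (fun x : α => _)]
  rw [Finset.sum_comm]
  refine Finset.sum_congr rfl fun x _ => ?_
  rw [← Finset.card_filter, ← Fintype.card_piFinset_const]
  congr 1
  ext y
  simp [Fintype.mem_piFinset]

/-- Counting pairs `(y, x)` with every `y j` in the fibre over `x` and applying the power mean
inequality, the common links have average density at least `c ^ (t + 1)`. Non-injective `y`
contribute less than half of this for large `n`, so some injective `y` keeps the other half. -/
theorem exists_dense_common_link {k n t : ℕ} {c : ℝ} (hc : 0 < c) (hn0 : 0 < n) (htn : t + 1 ≤ n)
    (hn : 2 * ((t + 1 : ℕ) : ℝ) ^ 2 < c ^ (t + 1) * n) (R : Finset (Fin (k + 1) → Fin n))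
    (hR : c * (n : ℝ) ^ (k + 1) ≤ R.card) :
    ∃ y : Fin (t + 1) → Fin n, Function.Injective y ∧
      c ^ (t + 1) / 2 * (n : ℝ) ^ k ≤
        ((Finset.univ.filter (fun x : Fin k → Fin n =>
          ∀ j, (Fin.cons (y j) x : Fin (k + 1) → Fin n) ∈ R)).card : ℝ) := by
  by_contra! hcon
  have hn' : (0 : ℝ) < n := by exact_mod_cast hn0
  set N : (Fin (t + 1) → Fin n) → ℕ := fun y => (Finset.univ.filter (fun x : Fin k → Fin n =>
          ∀ j, (Fin.cons (y j) x : Fin (k + 1) → Fin n) ∈ R)).card with hN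
  set D : (Fin k → Fin n) → ℕ := fun x => (Finset.univ.filter (fun v : Fin n =>
    (Fin.cons v x : Fin (k + 1) → Fin n) ∈ R)).card with hD
  have hsum : ∑ y, N y = ∑ x, D x ^ (t + 1) :=
    sum_card_common_eq (fun v x => (Fin.cons v x : Fin (k + 1) → Fin n) ∈ R) (t + 1)
  have hsumR : (∑ y, (N y : ℝ)) = ∑ x, (D x : ℝ) ^ (t + 1) := by exact_mod_cast hsum
  have hRD : (R.card : ℝ) = ∑ x, (D x : ℝ) := by exact_mod_cast card_eq_sum_card_cons R
  have hlow : c ^ (t + 1) * (n : ℝ) ^ (t + 1) * (n : ℝ) ^ k ≤ ∑ y, (N y : ℝ) := by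
    rw [hsumR]
    refine le_trans ?_ (pow_sum_div_card_le_sum_pow (s := Finset.univ)
      (f := fun x => (D x : ℝ)) (fun _ _ => Nat.cast_nonneg _) t)
    rw [← hRD, Finset.card_univ, Fintype.card_fun, Fintype.card_fin, Fintype.card_fin]
    push_cast
    rw [le_div_iff₀ (by positivity)]
    calc _ = (c * (n : ℝ) ^ (k + 1)) ^ (t + 1) := by ring
      _ ≤ _ := pow_le_pow_left₀ (by positivity) hR _
  have hup : ∑ y, (N y : ℝ) ≤ (n : ℝ) ^ (t + 1) * (c ^ (t + 1) / 2 * (n : ℝ) ^ k) +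
      ((t + 1 : ℕ) : ℝ) ^ 2 / n * (n : ℝ) ^ (t + 1) * (n : ℝ) ^ k := by
    rw [← Finset.sum_filter_add_sum_filter_not Finset.univ
      (fun y : Fin (t + 1) → Fin n => Function.Injective y)]
    refine add_le_add ?_ ?_
    · refine (Finset.sum_le_card_nsmul _ _ (c ^ (t + 1) / 2 * (n : ℝ) ^ k) ?_).trans ?_
      · intro y hy
        exact (hcon y (Finset.mem_filter.1 hy).2).le
      · rw [nsmul_eq_mul]
        refine mul_le_mul_of_nonneg_right ?_ (by positivity)
        have := Finset.card_le_univ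
          (Finset.univ.filter (fun y : Fin (t + 1) → Fin n => Function.Injective y))
        rw [Fintype.card_fun, Fintype.card_fin, Fintype.card_fin] at this
        exact_mod_cast this
    · refine (Finset.sum_le_card_nsmul _ _ ((n : ℝ) ^ k) ?_).trans ?_
      · intro y _
        have := Finset.card_le_univ (Finset.univ.filter (fun x : Fin k → Fin n =>
          ∀ j, (Fin.cons (y j) x : Fin (k + 1) → Fin n) ∈ R))
        rw [Fintype.card_fun, Fintype.card_fin, Fintype.card_fin] at this
        exact_mod_cast this
      · rw [nsmul_eq_mul]
        exact mul_le_mul_of_nonneg_right (card_not_injective_le hn0 htn) (by positivity)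
  have h := hlow.trans hup
  have hpos : (0 : ℝ) < (n : ℝ) ^ (t + 1) * (n : ℝ) ^ k := by positivity
  have h2 : ((t + 1 : ℕ) : ℝ) ^ 2 / n < c ^ (t + 1) / 2 := by
    rw [div_lt_iff₀ hn']; linarith
  have h3 : c ^ (t + 1) * ((n : ℝ) ^ (t + 1) * (n : ℝ) ^ k) ≤
      (c ^ (t + 1) / 2 + ((t + 1 : ℕ) : ℝ) ^ 2 / n) * ((n : ℝ) ^ (t + 1) * (n : ℝ) ^ k) := by
    linarith
  have h4 := le_of_mul_le_mul_right h3 hpos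
  linarith

/-- Erdős: a dense `k`-ary relation contains a complete box with sides of size `t + 1`. -/
theorem exists_box (t k : ℕ) : ∀ c : ℝ, 0 < c → ∃ n₀ : ℕ, ∀ n ≥ n₀, ∀ R : Finset (Fin k → Fin n),
    c * (n : ℝ) ^ k ≤ R.card → ∃ A : Fin k → Fin (t + 1) → Fin n,
      (∀ i, Function.Injective (A i)) ∧ ∀ s : Fin k → Fin (t + 1), (fun i => A i (s i)) ∈ R := by
  induction k with
  | zero =>
    intro c hc
    refine ⟨0, fun n _ R hR => ⟨fun i => i.elim0, fun i => i.elim0, fun s => ?_⟩⟩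
    have hpos : 0 < R.card := by
      rw [pow_zero, mul_one] at hR
      exact_mod_cast hc.trans_le hR
    obtain ⟨x, hx⟩ := Finset.card_pos.1 hpos
    convert hx
  | succ k ih =>
    intro c hc
    obtain ⟨n₁, h₁⟩ := ih (c ^ (t + 1) / 2) (by positivity)
    obtain ⟨n₂, h₂⟩ := exists_nat_gt (2 * ((t + 1 : ℕ) : ℝ) ^ 2 / c ^ (t + 1))
    refine ⟨max n₁ (max n₂ (t + 1)), fun n hn R hR => ?_⟩
    -- The box is built one coordinate at a time: `y` is its first side, and the remaining sides
    -- come from induction inside the common link of `y`.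
    simp only [ge_iff_le, max_le_iff] at hn
    have hn2 : 2 * ((t + 1 : ℕ) : ℝ) ^ 2 < c ^ (t + 1) * n := by
      rw [div_lt_iff₀ (by positivity)] at h₂
      have : (n₂ : ℝ) ≤ n := by exact_mod_cast hn.2.1
      have := mul_le_mul_of_nonneg_left this (show 0 ≤ c ^ (t + 1) by positivity)
      linarith
    obtain ⟨y, hy, hyR⟩ := exists_dense_common_link hc (by omega) hn.2.2 hn2 R hR
    obtain ⟨A, hA, hAR⟩ := h₁ n hn.1 _ hyR
    refine ⟨Fin.cons y A, fun i => ?_, fun s => ?_⟩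
    · refine Fin.cases ?_ (fun i => ?_) i
      · simpa using hy
      · simpa using hA i
    · have := (Finset.mem_filter.1 (hAR (Fin.tail s))).2 (s 0)
      convert this using 1
      funext i
      refine Fin.cases ?_ (fun i => ?_) i <;> simp [Fin.tail]

theorem exists_box_fintype {W : Type*} [Fintype W] [DecidableEq W] (t : ℕ) {c : ℝ} (hc : 0 < c) :
    ∃ n₀ : ℕ, ∀ n ≥ n₀, ∀ R : Finset (W → Fin n),
    c * (n : ℝ) ^ Fintype.card W ≤ R.card → ∃ A : W → Fin (t + 1) → Fin n,
      (∀ i, Function.Injective (A i)) ∧ ∀ s : W → Fin (t + 1), (fun i => A i (s i)) ∈ R := by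
  obtain ⟨n₀, h⟩ := exists_box t (Fintype.card W) c hc
  refine ⟨n₀, fun n hn R hR => ?_⟩
  let σ := Fintype.equivFin W
  obtain ⟨A, hA, hAR⟩ := h n hn (R.map (σ.arrowCongr (Equiv.refl _)).toEmbedding)
    (by rwa [Finset.card_map])
  refine ⟨fun w => A (σ w), fun w => hA _, fun s => ?_⟩
  have := hAR (s ∘ σ.symm)
  rw [Finset.mem_map_equiv] at this
  convert this using 1
  funext w
  simp [Equiv.arrowCongr]

end Box

namespace RGraph

/-! ### Supersaturation: many copies force a blow-up -/

section BlowUp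

variable {r : ℕ} {W : Type*} [Fintype W] [DecidableEq W]

/-- The injective homomorphisms from `G` to `H`. -/
def copies {V : Type*} [Fintype V] [DecidableEq V] (G : RGraph r W) (H : RGraph r V) :
    Finset (W → V) :=
  Finset.univ.filter (fun x => Function.Injective x ∧ ∀ e ∈ G.edges, e.image x ∈ H.edges)

theorem mem_copies {V : Type*} [Fintype V] [DecidableEq V] {G : RGraph r W} {H : RGraph r V}
    {x : W → V} :
    x ∈ G.copies H ↔ Function.Injective x ∧ ∀ e ∈ G.edges, e.image x ∈ H.edges := by
  simp [copies]

/-- A box in the relation of injective homomorphisms is a blow-up of `G`. Its sides are pairwise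
disjoint, because any two entries from different sides occur together in one injective selection. -/
theorem exists_blowUp_of_card_copies (G : RGraph r W) (t : ℕ) {c : ℝ} (hc : 0 < c) :
    ∃ n₀ : ℕ, ∀ n ≥ n₀, ∀ H : RGraph r (Fin n),
      c * (n : ℝ) ^ Fintype.card W ≤ (G.copies H).card → (G.blowUp t).IsContainedIn H := by
  obtain ⟨n₀, h⟩ := exists_box_fintype (W := W) t hc
  refine ⟨n₀, fun n hn H hH => ?_⟩
  obtain ⟨A, hA, hAR⟩ := h n hn _ hH
  have hinj : Function.Injective (fun p : W × Fin t => A p.1 p.2.castSucc) := by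
    rintro ⟨i, a⟩ ⟨j, b⟩ hab
    simp only at hab
    have hij : i = j := by
      by_contra hij
      have := (mem_copies.1 (hAR (Function.update (fun _ => b.castSucc) i a.castSucc))).1
      refine hij (this ?_)
      simp [Function.update_of_ne (Ne.symm hij), hab]
    subst hij
    simpa using hA i hab
  refine ⟨⟨_, hinj⟩, fun e he => ?_⟩
  have he' := (Finset.mem_filter.1 he).2
  have hcard := (Finset.mem_powersetCard.1 (Finset.mem_filter.1 he).1).2
  have hfst : Set.InjOn Prod.fst (e : Set (W × Fin t)) :=
    Finset.card_image_iff.1 (by rw [G.card_eq _ he', hcard])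
  -- An edge meets each class at most once, so a single selection from the box picks all its
  -- vertices. The extra element of `Fin (t + 1)` supplies the default `0` on unmet classes even
  -- when `t = 0`.
  have hs : ∃ s : W → Fin (t + 1), ∀ p ∈ e, s p.1 = p.2.castSucc := by
    classical
    refine ⟨fun w => if hw : ∃ p ∈ e, p.1 = w then hw.choose.2.castSucc else 0, fun p hp => ?_⟩
    have hw : ∃ q ∈ e, q.1 = p.1 := ⟨p, hp, rfl⟩
    simp only [dif_pos hw]
    rw [hfst hw.choose_spec.1 hp hw.choose_spec.2]
  obtain ⟨s, hs⟩ := hs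
  have := (mem_copies.1 (hAR s)).2 _ he'
  rw [Finset.image_image] at this
  convert this using 1
  rw [Finset.map_eq_image]
  refine Finset.image_congr fun p hp => ?_
  simp [hs p hp]

theorem exists_isContainedIn_of_card_copies {m : ℕ} {F : RGraph r (Fin m)} {G : RGraph r W}
    (hF : F.HomTo G) {c : ℝ} (hc : 0 < c) :
    ∃ n₀ : ℕ, ∀ n ≥ n₀, ∀ H : RGraph r (Fin n),
      c * (n : ℝ) ^ Fintype.card W ≤ (G.copies H).card → F.IsContainedIn H := by
  obtain ⟨n₀, h⟩ := exists_blowUp_of_card_copies G m hc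
  exact ⟨n₀, fun n hn H hH => hF.isContainedIn_blowUp.trans (h n hn H hH)⟩

end BlowUp

end RGraph

namespace RGraph

/-! ### Counting edges and triangles from the positive co-degree -/

section Counting

variable {r : ℕ} {V : Type*} [Fintype V] [DecidableEq V]

theorem mem_copies_singleEdge {H : RGraph r V} {x : Fin r → V} :
    x ∈ (singleEdge r).copies H ↔ Finset.univ.image x ∈ H.edges := by
  simp only [mem_copies, singleEdge, Finset.mem_singleton, forall_eq]
  refine ⟨fun h => h.2, fun h => ⟨?_, h⟩⟩
  have := H.card_eq _ h
  rw [← Set.injOn_univ, ← Finset.coe_univ, ← Finset.card_image_iff, this, Finset.card_univ,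
    Fintype.card_fin]

/-- The common neighbours of the edge tuple `y` with its `i`-th vertex left out. -/
def tupleNbr (H : RGraph r V) (y : Fin r → V) (i : Fin r) : Finset V :=
  H.nbr ((Finset.univ.erase i).image y)

theorem HasPosCodegree.le_card_tupleNbr {H : RGraph r V} {d : ℕ} (h : H.HasPosCodegree d)
    {y : Fin r → V} (hy : y ∈ (singleEdge r).copies H) (i : Fin r) :
    d ≤ (H.tupleNbr y i).card := by
  refine h.2 _ ?_ ⟨_, mem_copies_singleEdge.1 hy,
    Finset.image_subset_image (Finset.erase_subset _ _)⟩
  rw [Finset.card_image_of_injective _ (mem_copies.1 hy).1,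
    Finset.card_erase_of_mem (Finset.mem_univ _), Finset.card_univ, Fintype.card_fin]

theorem exists_tuple_of_nonempty {H : RGraph r V} (h : H.edges.Nonempty) :
    ∃ x, x ∈ (singleEdge r).copies H := by
  obtain ⟨e, he⟩ := h
  let σ := e.equivFinOfCardEq (H.card_eq e he)
  refine ⟨fun i => (σ.symm i).1, mem_copies_singleEdge.2 ?_⟩
  convert he
  ext v
  simp only [Finset.mem_image, Finset.mem_univ, true_and]
  exact ⟨fun ⟨i, hi⟩ => hi ▸ (σ.symm i).2, fun hv => ⟨σ ⟨v, hv⟩, by simp⟩⟩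

omit [Fintype V] in
theorem image_update_eq {y : Fin r → V} {a : Fin r} {v : V} :
    Finset.univ.image (Function.update y a v) = insert v ((Finset.univ.erase a).image y) := by
  rw [← Finset.insert_erase (Finset.mem_univ a), Finset.image_insert, Function.update_self,
    Finset.erase_insert_eq_erase, Finset.erase_idem]
  congr 1
  refine Finset.image_congr fun i hi => ?_
  exact Function.update_of_ne (Finset.ne_of_mem_erase (by exact_mod_cast hi)) _ _

/-- Start from one edge tuple `x₀` and free its coordinates one by one: each new coordinate has at
least `d` values, since the other `r - 1` entries always lie in an edge. A replacement at `a` is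
reversible because the old entry was `x₀ a`. -/
theorem HasPosCodegree.pow_le_card_copies {H : RGraph r V} {d : ℕ} (h : H.HasPosCodegree d) :
    d ^ r ≤ ((singleEdge r).copies H).card := by
  obtain ⟨x₀, hx₀⟩ := exists_tuple_of_nonempty h.1
  have key : ∀ J : Finset (Fin r), d ^ J.card ≤
      (((singleEdge r).copies H).filter (fun y => ∀ i ∉ J, y i = x₀ i)).card := by
    intro J
    induction J using Finset.induction_on with
    | empty =>
      simp only [Finset.card_empty, pow_zero]
      exact Finset.card_pos.2 ⟨x₀, Finset.mem_filter.2 ⟨hx₀, by simp⟩⟩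
    | insert a J ha ih =>
      rw [Finset.card_insert_of_notMem ha, pow_succ]
      set E := ((singleEdge r).copies H).filter (fun y => ∀ i ∉ J, y i = x₀ i) with hE
      calc d ^ J.card * d ≤ E.card * d := Nat.mul_le_mul_right _ ih
        _ ≤ (E.sigma (fun y => H.tupleNbr y a)).card := by
          rw [Finset.card_sigma, ← smul_eq_mul]
          exact Finset.card_nsmul_le_sum _ _ _ fun y hy =>
            h.le_card_tupleNbr (Finset.mem_filter.1 hy).1 a
        _ ≤ _ := by
          refine Finset.card_le_card_of_injOn (fun p => Function.update p.1 a p.2) ?_ ?_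
          · rintro ⟨y, v⟩ hp
            obtain ⟨hy, hv⟩ := Finset.mem_sigma.1 (Finset.mem_coe.1 hp)
            refine Finset.mem_coe.2 (Finset.mem_filter.2 ⟨mem_copies_singleEdge.2 ?_, ?_⟩)
            · rw [image_update_eq]
              exact (mem_nbr.1 hv).2
            · intro i hi
              rw [Finset.mem_insert, not_or] at hi
              simp only [Function.update_of_ne hi.1]
              exact (Finset.mem_filter.1 hy).2 i hi.2
          · rintro ⟨y, v⟩ hp ⟨y', v'⟩ hp' heq
            have hy := (Finset.mem_filter.1 (Finset.mem_sigma.1 (Finset.mem_coe.1 hp)).1).2 a ha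
            have hy' := (Finset.mem_filter.1 (Finset.mem_sigma.1 (Finset.mem_coe.1 hp')).1).2 a ha
            simp only at heq hy hy'
            have hv : v = v' := by simpa using congrFun heq a
            have hyy : y = y' := by
              funext i
              by_cases hi : i = a
              · subst hi; rw [hy, hy']
              · simpa [Function.update_of_ne hi] using congrFun heq i
            rw [hv, hyy]
  have := key Finset.univ
  rw [Finset.card_univ, Fintype.card_fin] at this
  exact this.trans (Finset.card_filter_le _ _)

/-- The vertices that lie in two of the neighbourhoods of the `(r-1)`-subsets of an edge. -/
def doubleNbr (H : RGraph r V) (y : Fin r → V) : Finset V :=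
  Finset.univ.filter (fun v => ∃ i j, i ≠ j ∧ v ∈ H.tupleNbr y i ∧ v ∈ H.tupleNbr y j)

/-- Double count the pairs `(i, v)` with `v` in the `i`-th neighbourhood: a vertex outside
`doubleNbr` is counted at most once, any other at most `r` times. -/
theorem HasPosCodegree.le_card_doubleNbr {H : RGraph r V} {d : ℕ} (h : H.HasPosCodegree d)
    {y : Fin r → V} (hy : y ∈ (singleEdge r).copies H) :
    r * d ≤ Fintype.card V + r * (H.doubleNbr y).card := by
  calc r * d ≤ ∑ i : Fin r, (H.tupleNbr y i).card := by
        have := Finset.card_nsmul_le_sum Finset.univ (fun i => (H.tupleNbr y i).card) d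
          (fun i _ => h.le_card_tupleNbr hy i)
        simpa using this
    _ = ∑ v : V, (Finset.univ.filter (fun i => v ∈ H.tupleNbr y i)).card := by
        have := Finset.sum_card_bipartiteAbove_eq_sum_card_bipartiteBelow
          (s := (Finset.univ : Finset (Fin r))) (t := (Finset.univ : Finset V))
          (fun i v => v ∈ H.tupleNbr y i)
        simpa [Finset.bipartiteAbove, Finset.bipartiteBelow] using this
    _ ≤ ∑ v : V, (1 + if v ∈ H.doubleNbr y then r else 0) := by
        refine Finset.sum_le_sum fun v _ => ?_
        split_ifs with hv
        · have := Finset.card_le_univ (Finset.univ.filter (fun i => v ∈ H.tupleNbr y i))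
          rw [Fintype.card_fin] at this
          omega
        · rw [add_zero, Finset.card_le_one]
          intro i hi j hj
          by_contra hij
          exact hv (Finset.mem_filter.2 ⟨Finset.mem_univ _, i, j, hij,
            (Finset.mem_filter.1 hi).2, (Finset.mem_filter.1 hj).2⟩)
    _ = _ := by
        rw [Finset.sum_add_distrib, ← Finset.sum_filter]
        simp [mul_comm]

/-- The `r`-triangle on `Option (Fin r)` whose edges miss `none`, `i` and `j`, respectively. -/
def optionTriangle (i j : Fin r) : RGraph r (Option (Fin r)) where
  edges := ({none, some i, some j} : Finset (Option (Fin r))).image (fun a => Finset.univ.erase a)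
  card_eq := by
    intro e he
    obtain ⟨a, -, rfl⟩ := Finset.mem_image.1 he
    rw [Finset.card_erase_of_mem (Finset.mem_univ _), Finset.card_univ]
    simp

/-- The three edges are `y` itself and `y` with its `i`-th or its `j`-th vertex replaced by `v`.
Since `i ≠ j`, the two membership hypotheses together keep `v` off every entry of `y`. -/
theorem elim_mem_copies_optionTriangle {H : RGraph r V} {y : Fin r → V} {v : V} {i j : Fin r}
    (hij : i ≠ j) (hy : y ∈ (singleEdge r).copies H) (hi : v ∈ H.tupleNbr y i)
    (hj : v ∈ H.tupleNbr y j) : (fun o => Option.elim o v y) ∈ (optionTriangle i j).copies H := by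
  have hv : ∀ k, y k ≠ v := by
    intro k hk
    by_cases hki : k = i
    · refine (mem_nbr.1 hj).1 (Finset.mem_image.2 ⟨k, Finset.mem_erase.2 ⟨?_, Finset.mem_univ _⟩, hk⟩)
      rw [hki]; exact hij
    · exact (mem_nbr.1 hi).1
        (Finset.mem_image.2 ⟨k, Finset.mem_erase.2 ⟨hki, Finset.mem_univ _⟩, hk⟩)
  have hsome : ∀ k, (Finset.univ.erase (some k)).image (fun o => Option.elim o v y) =
      insert v ((Finset.univ.erase k).image y) := by
    intro k
    ext u
    simp only [Finset.mem_image, Finset.mem_erase, Finset.mem_univ, and_true, Finset.mem_insert]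
    constructor
    · rintro ⟨_ | l, hl, rfl⟩
      · exact Or.inl rfl
      · exact Or.inr ⟨l, fun h => hl (by rw [h]), rfl⟩
    · rintro (rfl | ⟨l, hl, rfl⟩)
      · exact ⟨none, by simp, rfl⟩
      · exact ⟨some l, by simpa using hl, rfl⟩
  have hnone : (Finset.univ.erase none).image (fun o => Option.elim o v y) =
      Finset.univ.image y := by
    ext u
    simp only [Finset.mem_image, Finset.mem_erase, Finset.mem_univ, and_true, true_and]
    constructor
    · rintro ⟨_ | l, hl, rfl⟩
      · exact absurd rfl hl
      · exact ⟨l, rfl⟩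
    · rintro ⟨l, rfl⟩
      exact ⟨some l, by simp, rfl⟩
  refine mem_copies.2 ⟨?_, ?_⟩
  · rintro (_ | k) (_ | l) hkl
    · rfl
    · exact absurd hkl.symm (hv l)
    · exact absurd hkl (hv k)
    · rw [(mem_copies.1 hy).1 hkl]
  · intro e he
    obtain ⟨a, ha, rfl⟩ := Finset.mem_image.1 he
    simp only [Finset.mem_insert, Finset.mem_singleton] at ha
    obtain rfl | rfl | rfl := ha
    · rw [hnone]; exact mem_copies_singleEdge.1 hy
    · rw [hsome]; exact (mem_nbr.1 hi).2
    · rw [hsome]; exact (mem_nbr.1 hj).2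

/-- Each of the at least `d ^ r` edge tuples has at least `b` double neighbours. Every resulting
pair is a copy of `optionTriangle i j` for some `i ≠ j`; the most popular of the at most `r ^ 2`
index pairs gets its share. -/
theorem HasPosCodegree.exists_card_copies_optionTriangle (hr : 2 ≤ r) {H : RGraph r V} {d : ℕ}
    (h : H.HasPosCodegree d) {b : ℝ} (hb : 0 ≤ b)
    (hd : (Fintype.card V : ℝ) + r * b ≤ r * d) :
    ∃ i j : Fin r, i ≠ j ∧
      (d : ℝ) ^ r * b ≤ (r : ℝ) ^ 2 * ((optionTriangle i j).copies H).card := by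
  have hne : (Finset.univ.offDiag : Finset (Fin r × Fin r)).Nonempty :=
    ⟨(⟨0, by omega⟩, ⟨1, by omega⟩), by simp⟩
  obtain ⟨⟨i, j⟩, hij, hmax⟩ := Finset.exists_max_image _
    (fun p : Fin r × Fin r => ((optionTriangle p.1 p.2).copies H).card) hne
  refine ⟨i, j, by simpa using hij, ?_⟩
  have hr0 : (0 : ℝ) < r := by exact_mod_cast (by omega : 0 < r)
  set E := (singleEdge r).copies H with hE
  have h1 : (E.sigma (fun y => H.doubleNbr y)).card ≤
      r ^ 2 * ((optionTriangle i j).copies H).card := by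
    calc (E.sigma (fun y => H.doubleNbr y)).card
        ≤ (Finset.univ.offDiag.biUnion
            (fun p : Fin r × Fin r => (optionTriangle p.1 p.2).copies H)).card := by
          refine Finset.card_le_card_of_injOn (fun p o => Option.elim o p.2 p.1) ?_ ?_
          · rintro ⟨y, v⟩ hp
            obtain ⟨hy, hv⟩ := Finset.mem_sigma.1 (Finset.mem_coe.1 hp)
            obtain ⟨-, k, l, hkl, hk, hl⟩ := Finset.mem_filter.1 hv
            exact Finset.mem_coe.2 (Finset.mem_biUnion.2 ⟨(k, l), by simpa using hkl,
              elim_mem_copies_optionTriangle hkl hy hk hl⟩)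
          · rintro ⟨y, v⟩ - ⟨y', v'⟩ - heq
            have hv : v = v' := congrFun heq none
            have hy : y = y' := funext fun i => congrFun heq (some i)
            rw [hv, hy]
      _ ≤ (Finset.univ.offDiag : Finset (Fin r × Fin r)).card *
            ((optionTriangle i j).copies H).card :=
          Finset.card_biUnion_le_card_mul _ _ _ hmax
      _ ≤ _ := by
          refine Nat.mul_le_mul_right _ ?_
          rw [Finset.offDiag_card, Finset.card_univ, Fintype.card_fin, sq]
          exact Nat.sub_le _ _
  have h2 : (E.card : ℝ) * b ≤ ((E.sigma (fun y => H.doubleNbr y)).card : ℝ) := by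
    rw [Finset.card_sigma, ← nsmul_eq_mul]
    push_cast
    refine Finset.card_nsmul_le_sum _ _ _ fun y hy => ?_
    have h3 : (r : ℝ) * d ≤ Fintype.card V + r * (H.doubleNbr y).card := by
      exact_mod_cast h.le_card_doubleNbr hy
    exact le_of_mul_le_mul_left (by linarith) hr0
  have h4 : (d : ℝ) ^ r ≤ E.card := by exact_mod_cast h.pow_le_card_copies
  calc (d : ℝ) ^ r * b ≤ E.card * b := mul_le_mul_of_nonneg_right h4 hb
    _ ≤ _ := h2.trans (by exact_mod_cast h1)

end Counting

/-! ### Uniqueness of the `r`-triangle -/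

section Triangle

variable {r : ℕ}

theorem edge_eq_univ_erase {T : RGraph r (Fin (r + 1))} {e : Finset (Fin (r + 1))}
    (he : e ∈ T.edges) : ∃ a, Finset.univ.erase a = e := by
  have h : eᶜ.card = 1 := by
    rw [Finset.card_compl, T.card_eq e he, Fintype.card_fin]; omega
  obtain ⟨a, ha⟩ := Finset.card_eq_one.1 h
  refine ⟨a, ?_⟩
  rw [← compl_compl e, ha, Finset.compl_singleton]

theorem IsTriangle.exists_missing {T : RGraph r (Fin (r + 1))} (hT : T.IsTriangle) :
    ∃ p q s : Fin (r + 1), p ≠ q ∧ p ≠ s ∧ q ≠ s ∧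
      ∀ e ∈ T.edges, e = Finset.univ.erase p ∨ e = Finset.univ.erase q ∨
        e = Finset.univ.erase s := by
  obtain ⟨e₁, e₂, e₃, h12, h13, h23, hE⟩ := Finset.card_eq_three.1 hT
  obtain ⟨p, rfl⟩ := edge_eq_univ_erase (T := T) (e := e₁) (by simp [hE])
  obtain ⟨q, rfl⟩ := edge_eq_univ_erase (T := T) (e := e₂) (by simp [hE])
  obtain ⟨s, rfl⟩ := edge_eq_univ_erase (T := T) (e := e₃) (by simp [hE])
  exact ⟨p, q, s, fun h => h12 (by rw [h]), fun h => h13 (by rw [h]), fun h => h23 (by rw [h]),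
    fun e he => by simpa [hE] using he⟩

theorem exists_equiv_of_distinct {α β : Type*} [Fintype α] [Fintype β] [DecidableEq α]
    [DecidableEq β] (h : Fintype.card α = Fintype.card β) {p q s : α} {p' q' s' : β} (hpq : p ≠ q)
    (hps : p ≠ s) (hqs : q ≠ s) (hpq' : p' ≠ q') (hps' : p' ≠ s') (hqs' : q' ≠ s') :
    ∃ τ : α ≃ β, τ p = p' ∧ τ q = q' ∧ τ s = s' := by
  obtain ⟨σ⟩ := Fintype.card_eq.1 h
  let σ₁ := σ.trans (Equiv.swap (σ p) p')
  have h1 : σ₁ p = p' := by simp [σ₁]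
  let σ₂ := σ₁.trans (Equiv.swap (σ₁ q) q')
  have h2 : σ₂ q = q' := by simp [σ₂]
  have h2p : σ₂ p = p' := by
    simp only [σ₂, Equiv.trans_apply, h1]
    exact Equiv.swap_apply_of_ne_of_ne (fun hh => hpq (σ₁.injective (h1.trans hh))) hpq'
  refine ⟨σ₂.trans (Equiv.swap (σ₂ s) s'), ?_, ?_, by simp⟩
  · simp only [Equiv.trans_apply, h2p]
    exact Equiv.swap_apply_of_ne_of_ne (fun hh => hps (σ₂.injective (h2p.trans hh))) hps'
  · simp only [Equiv.trans_apply, h2]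
    exact Equiv.swap_apply_of_ne_of_ne (fun hh => hqs (σ₂.injective (h2.trans hh))) hqs'

/-- Each edge is the complement of one vertex, so any bijection that matches the three missed
vertices carries edges to edges. -/
theorem IsTriangle.homTo_optionTriangle {T : RGraph r (Fin (r + 1))} (hT : T.IsTriangle)
    {i j : Fin r} (hij : i ≠ j) : T.HomTo (optionTriangle i j) := by
  obtain ⟨p, q, s, hpq, hps, hqs, hE⟩ := hT.exists_missing
  obtain ⟨τ, hp, hq, hs⟩ := exists_equiv_of_distinct (α := Fin (r + 1)) (β := Option (Fin r))
    (by simp) hpq hps hqs (p' := none) (q' := some i) (s' := some j) (by simp) (by simp)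
    (by simpa using hij)
  have himg : ∀ a, (Finset.univ.erase a).image τ = Finset.univ.erase (τ a) := fun a => by
    rw [Finset.image_erase τ.injective, Finset.image_univ_equiv]
  refine ⟨τ, fun e he => ?_⟩
  rcases hE e he with rfl | rfl | rfl <;> rw [himg] <;> simp [optionTriangle, hp, hq, hs]

end Triangle

end RGraph

/-! ### Upper bounds 0 and 1/r -/

section UpperBounds

variable {r : ℕ} {𝓕 : RGraphFamily r}

theorem eventually_coPosEx_le_of_isPartite (hr : 1 ≤ r) {F : Σ m : ℕ, RGraph r (Fin m)}
    (hF : F ∈ 𝓕) (hP : F.2.IsPartite r) {ε : ℝ} (hε : 0 < ε) :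
    ∀ᶠ n : ℕ in atTop, (coPosEx n 𝓕 : ℝ) ≤ ε * n := by
  obtain ⟨n₀, h⟩ := exists_isContainedIn_of_card_copies (isPartite_iff_homTo.1 hP)
    (show 0 < ε ^ r by positivity)
  filter_upwards [eventually_ge_atTop n₀] with n hn
  by_contra! hcon
  have hpos : 0 < coPosEx n 𝓕 := by
    have : (0 : ℝ) < coPosEx n 𝓕 := lt_of_le_of_lt (by positivity) hcon
    exact_mod_cast this
  obtain ⟨H, hfree, hH⟩ := exists_free_of_coPosEx_pos hr hpos
  refine hfree F hF (h n hn H ?_)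
  have h1 : (coPosEx n 𝓕 : ℝ) ^ r ≤ ((singleEdge r).copies H).card := by
    exact_mod_cast hH.pow_le_card_copies
  refine le_trans ?_ h1
  rw [Fintype.card_fin, ← mul_pow]
  exact pow_le_pow_left₀ (by positivity) hcon.le _

theorem eventually_coPosEx_le_of_homTo_triangle (hr : 2 ≤ r) {F : Σ m : ℕ, RGraph r (Fin m)}
    (hF : F ∈ 𝓕) {T : RGraph r (Fin (r + 1))} (hT : T.IsTriangle) (hFT : F.2.HomTo T) {ε : ℝ}
    (hε : 0 < ε) : ∀ᶠ n : ℕ in atTop, (coPosEx n 𝓕 : ℝ) ≤ (1 / r + ε) * n := by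
  have hr0 : (0 : ℝ) < r := by exact_mod_cast (by omega : 0 < r)
  -- At least `(n/r) ^ r` edge tuples, `εn` double neighbours for each, shared among at most `r ^ 2`
  -- index pairs.
  set c : ℝ := (1 / r) ^ r * ε / r ^ 2 with hc
  have hc0 : 0 < c := by positivity
  have hex : ∀ p : Fin r × Fin r, ∃ n₀ : ℕ, p.1 ≠ p.2 → ∀ n ≥ n₀, ∀ H : RGraph r (Fin n),
      c * (n : ℝ) ^ (r + 1) ≤ ((optionTriangle p.1 p.2).copies H).card → F.2.IsContainedIn H := by
    -- The threshold is chosen for every pair, with a dummy value on the diagonal, so that one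
    -- maximum over all pairs can be taken before `H` determines which pair is needed.
    intro p
    by_cases hp : p.1 = p.2
    · exact ⟨0, fun h => absurd hp h⟩
    · obtain ⟨n₀, h⟩ := exists_isContainedIn_of_card_copies
        (hFT.trans (hT.homTo_optionTriangle hp)) hc0
      refine ⟨n₀, fun _ => ?_⟩
      simpa using h
  choose N hN using hex
  filter_upwards [eventually_ge_atTop (Finset.univ.sup N)] with n hn
  by_contra! hcon
  have hpos : 0 < coPosEx n 𝓕 := by
    have : (0 : ℝ) < coPosEx n 𝓕 := lt_of_le_of_lt (by positivity) hcon
    exact_mod_cast this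
  obtain ⟨H, hfree, hH⟩ := exists_free_of_coPosEx_pos (by omega) hpos
  obtain ⟨i, j, hij, hcard⟩ := hH.exists_card_copies_optionTriangle hr (b := ε * n) (by positivity)
    (by
      rw [Fintype.card_fin]
      have := mul_le_mul_of_nonneg_left hcon.le hr0.le
      refine le_trans (le_of_eq ?_) this
      field_simp)
  refine hfree F hF (hN (i, j) hij n ((Finset.le_sup (Finset.mem_univ _)).trans hn) H ?_)
  have h1 : (1 / r * n : ℝ) ^ r ≤ (coPosEx n 𝓕 : ℝ) ^ r := by
    refine pow_le_pow_left₀ (by positivity) (le_trans ?_ hcon.le) _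
    exact mul_le_mul_of_nonneg_right (by linarith) (by positivity)
  have h2 : (1 / r * n : ℝ) ^ r * (ε * n) ≤
      (r : ℝ) ^ 2 * ((optionTriangle i j).copies H).card :=
    (mul_le_mul_of_nonneg_right h1 (by positivity)).trans hcard
  rw [hc, div_mul_eq_mul_div, div_le_iff₀ (by positivity)]
  calc _ = (1 / r * n : ℝ) ^ r * (ε * n) := by ring
    _ ≤ _ := by linarith

end UpperBounds

namespace RGraph

/-! ### Lower bounds from weighted blow-ups -/

section LowerBounds

variable {r : ℕ} {W : Type*} [Fintype W] [DecidableEq W]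

theorem exists_colouring [Nonempty W] {n : ℕ} (w : W → ℕ) (hw : ∑ u, w u ≤ n) :
    ∃ c : Fin n → W, ∀ u, w u ≤ (Finset.univ.filter (fun v => c v = u)).card := by
  obtain ⟨f⟩ : Nonempty ((Σ u : W, Fin (w u)) ↪ Fin n) :=
    Function.Embedding.nonempty_of_card_le (by simpa using hw)
  refine ⟨Function.extend f Sigma.fst (fun _ => Classical.arbitrary W), fun u => ?_⟩
  have h := Finset.card_le_card_of_injOn (s := (Finset.univ : Finset (Fin (w u))))
    (t := Finset.univ.filter
      (fun v => Function.extend f Sigma.fst (fun _ => Classical.arbitrary W) v = u))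
    (fun a => f ⟨u, a⟩)
    (by
      intro a _
      simp [f.injective.extend_apply])
    (by
      intro a _ b _ hab
      simpa using f.injective hab)
  simpa using h

/-- The vertices are split into classes of size at least `w u`; left-over vertices may join any
class. Positive weights make all classes nonempty, so the blow-up does have an edge. -/
theorem exists_hasPosCodegree_comap (hr : 1 ≤ r) {G : RGraph r W} (hG : G.edges.Nonempty) {n d : ℕ}
    {w : W → ℕ} (hpos : ∀ u, 0 < w u) (hw : ∑ u, w u ≤ n)
    (hd : ∀ S : Finset W, S.card = r - 1 → (∃ e ∈ G.edges, S ⊆ e) → d ≤ ∑ u ∈ G.nbr S, w u) :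
    ∃ c : Fin n → W, (G.comap c).HasPosCodegree d := by
  obtain ⟨e, he⟩ := hG
  have hW : Nonempty W := by
    have : 0 < e.card := by rw [G.card_eq e he]; omega
    exact ⟨(Finset.card_pos.1 this).choose⟩
  obtain ⟨c, hc⟩ := exists_colouring w hw
  have hsurj : Function.Surjective c := fun u => by
    obtain ⟨v, hv⟩ := Finset.card_pos.1 ((hpos u).trans_le (hc u))
    exact ⟨v, (Finset.mem_filter.1 hv).2⟩
  refine ⟨c, hasPosCodegree_comap hr ⟨e.image (Function.surjInv hsurj), ?_⟩ ?_⟩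
  · refine mem_comap_edges.2 ⟨?_, ?_⟩
    · rw [Finset.card_image_of_injective _ (Function.injective_surjInv hsurj), G.card_eq e he]
    · rw [Finset.image_image, (Function.rightInverse_surjInv hsurj).comp_eq_id, Finset.image_id]
      exact he
  · intro S _ hS hSe
    refine (hd _ hS hSe).trans ?_
    rw [Finset.card_eq_sum_card_fiberwise (f := c) (t := G.nbr (S.image c))
      (s := Finset.univ.filter (fun v => c v ∈ G.nbr (S.image c)))
      (fun v hv => Finset.mem_coe.2 (Finset.mem_filter.1 (Finset.mem_coe.1 hv)).2)]
    refine Finset.sum_le_sum fun u hu => (hc u).trans (Finset.card_le_card fun v hv => ?_)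
    have hv' := (Finset.mem_filter.1 hv).2
    exact Finset.mem_filter.2 ⟨Finset.mem_filter.2 ⟨Finset.mem_univ _, hv' ▸ hu⟩, hv'⟩

theorem eventually_le_coPosEx (hr : 1 ≤ r) {𝓕 : RGraphFamily r} {G : RGraph r W}
    (hG : G.edges.Nonempty) (hF : ∀ F ∈ 𝓕, ¬ F.2.HomTo G) {d : ℕ} {w : W → ℕ}
    (hpos : ∀ u, 0 < w u)
    (hd : ∀ S : Finset W, S.card = r - 1 → (∃ e ∈ G.edges, S ⊆ e) → d ≤ ∑ u ∈ G.nbr S, w u)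
    {s : ℕ} (hs : ∑ u, w u = s) {ε : ℝ} (hε : 0 < ε) :
    ∀ᶠ n : ℕ in atTop, ((d : ℝ) / s - ε) * n ≤ coPosEx n 𝓕 := by
  have hs0 : 0 < s := by
    obtain ⟨e, he⟩ := hG
    obtain ⟨u, -⟩ := Finset.card_pos.1 (show 0 < e.card by rw [G.card_eq e he]; omega)
    rw [← hs]
    exact (hpos u).trans_le (Finset.single_le_sum (fun _ _ => Nat.zero_le _) (Finset.mem_univ u))
  have hs1 : (0 : ℝ) < s := by exact_mod_cast hs0
  obtain ⟨n₀, hn₀⟩ := exists_nat_gt ((d : ℝ) / ε)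
  filter_upwards [eventually_ge_atTop n₀, eventually_ge_atTop s] with n hn hsn
  have ht : 0 < n / s := Nat.div_pos hsn hs0
  obtain ⟨c, hc⟩ := exists_hasPosCodegree_comap hr hG (n := n) (d := n / s * d)
    -- Scaling by the integer part of `n / s` loses at most `d` in the co-degree, which `ε * n`
    -- absorbs once `n > d / ε`.
    (w := fun u => n / s * w u) (fun u => Nat.mul_pos ht (hpos u))
    (by rw [← Finset.mul_sum, hs]; exact Nat.div_mul_le_self n s)
    (fun S hS he => by rw [← Finset.mul_sum]; exact Nat.mul_le_mul_left _ (hd S hS he))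
  have hfree : 𝓕.Free (G.comap c) := fun F hFm hcon => hF F hFm (homTo_of_isContainedIn_comap hcon)
  have h1 : ((n / s : ℕ) : ℝ) * d ≤ coPosEx n 𝓕 := by exact_mod_cast le_coPosEx hr hfree hc
  have h2 : (n : ℝ) ≤ s * ((n / s : ℕ) : ℝ) + s := by
    exact_mod_cast (by have := Nat.lt_div_mul_add (a := n) hs0; rw [mul_comm] at this; omega :
      n ≤ s * (n / s) + s)
  have h3 : (n : ℝ) / s ≤ ((n / s : ℕ) : ℝ) + 1 := by
    rw [div_le_iff₀ hs1]; linarith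
  have h4 : (d : ℝ) ≤ ε * n := by
    rw [div_lt_iff₀ hε] at hn₀
    have : (n₀ : ℝ) ≤ n := by exact_mod_cast hn
    nlinarith
  have h5 := mul_le_mul_of_nonneg_right h3 (Nat.cast_nonneg (α := ℝ) d)
  calc ((d : ℝ) / s - ε) * n = n / s * d - ε * n := by ring
    _ ≤ _ := by linarith

theorem exists_mem_nbr_singleEdge {S : Finset (Fin r)} (hr : 1 ≤ r) (hS : S.card = r - 1) :
    ((singleEdge r).nbr S).Nonempty := by
  obtain ⟨a, ha, h⟩ := Finset.exists_eq_insert_iff.2 ⟨Finset.subset_univ S,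
    show S.card + 1 = (Finset.univ : Finset (Fin r)).card by
      rw [Finset.card_univ, Fintype.card_fin]; omega⟩
  exact ⟨a, mem_nbr.2 ⟨ha, by simp [singleEdge, h]⟩⟩

theorem eventually_le_coPosEx_of_not_isPartite (hr : 1 ≤ r) {𝓕 : RGraphFamily r}
    (hF : ∀ F ∈ 𝓕, ¬ F.2.IsPartite r) {ε : ℝ} (hε : 0 < ε) :
    ∀ᶠ n : ℕ in atTop, (1 / (r : ℝ) - ε) * n ≤ coPosEx n 𝓕 := by
  have := eventually_le_coPosEx (G := singleEdge r) (d := 1) (w := fun _ => 1) (s := r) hr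
    (by simp [singleEdge]) (fun F h => fun h' => hF F h (isPartite_iff_homTo.2 h')) (by simp)
    (fun S hS _ => by simpa [Finset.one_le_card] using exists_mem_nbr_singleEdge hr hS)
    (by simp) hε
  simpa using this

/-- The `r`-graph on `r + 1` vertices whose edges each miss one element of `M`. -/
def missing (r : ℕ) (M : Finset (Fin (r + 1))) : RGraph r (Fin (r + 1)) where
  edges := M.image (fun a => Finset.univ.erase a)
  card_eq := by
    intro e he
    obtain ⟨a, -, rfl⟩ := Finset.mem_image.1 he
    rw [Finset.card_erase_of_mem (Finset.mem_univ _), Finset.card_univ]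
    simp

theorem erase_mem_missing {M : Finset (Fin (r + 1))} {a : Fin (r + 1)} (h : a ∈ M) :
    Finset.univ.erase a ∈ (missing r M).edges :=
  Finset.mem_image_of_mem _ h

theorem isTriangle_missing {M : Finset (Fin (r + 1))} (hM : M.card = 3) :
    (missing r M).IsTriangle := by
  unfold IsTriangle missing
  rw [Finset.card_image_of_injective, hM]
  intro a b hab
  by_contra h
  have : a ∈ Finset.univ.erase b := by simp [h]
  rw [← show Finset.univ.erase a = Finset.univ.erase b from hab] at this
  simp at this

/-- Such an `S` omits exactly two vertices `a` and `b`, with `a ∈ M`, and `b` completes it. If `b ∈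
M` then `a` completes it too and the weights are 1 + 1; otherwise `b` alone has weight 2. -/
theorem two_le_sum_nbr_missing (hr : 1 ≤ r) {M : Finset (Fin (r + 1))} {S : Finset (Fin (r + 1))}
    (hS : S.card = r - 1) (he : ∃ e ∈ (missing r M).edges, S ⊆ e) :
    2 ≤ ∑ u ∈ (missing r M).nbr S, (if u ∈ M then 1 else 2) := by
  obtain ⟨e, he, hSe⟩ := he
  obtain ⟨a, ha, rfl⟩ := Finset.mem_image.1 he
  obtain ⟨b, hb, hbS⟩ := Finset.exists_eq_insert_iff.2 ⟨hSe, by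
    rw [Finset.card_erase_of_mem (Finset.mem_univ _), Finset.card_univ, Fintype.card_fin]; omega⟩
  have hb' : b ∈ Finset.univ.erase a := hbS ▸ Finset.mem_insert_self b S
  have hba : b ≠ a := Finset.ne_of_mem_erase hb'
  have haS : a ∉ S := fun h => Finset.ne_of_mem_erase (hSe h) rfl
  have hbn : b ∈ (missing r M).nbr S := mem_nbr.2 ⟨hb, hbS ▸ he⟩
  by_cases hbM : b ∈ M
  · have hSb : insert a S = Finset.univ.erase b := by
      rw [← Finset.erase_insert hb, hbS, Finset.erase_right_comm, Finset.insert_erase]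
      simp [hba.symm]
    have han : a ∈ (missing r M).nbr S := mem_nbr.2 ⟨haS, hSb ▸ erase_mem_missing hbM⟩
    calc 2 = ∑ u ∈ {a, b}, (if u ∈ M then 1 else 2) := by
          rw [Finset.sum_pair hba.symm, if_pos ha, if_pos hbM]
      _ ≤ _ := Finset.sum_le_sum_of_subset (by
          intro u hu
          simp only [Finset.mem_insert, Finset.mem_singleton] at hu
          rcases hu with rfl | rfl <;> assumption)
  · calc 2 = (if b ∈ M then 1 else 2) := by rw [if_neg hbM]
      _ ≤ _ := Finset.single_le_sum (f := fun u => if u ∈ M then 1 else 2)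
        (fun _ _ => Nat.zero_le _) hbn

theorem eventually_le_coPosEx_of_not_homTo_triangle (hr : 2 ≤ r) {𝓕 : RGraphFamily r}
    (hF : ∀ F ∈ 𝓕, ∀ T : RGraph r (Fin (r + 1)), T.IsTriangle → ¬ F.2.HomTo T) {ε : ℝ}
    (hε : 0 < ε) :
    ∀ᶠ n : ℕ in atTop, (2 / (2 * (r : ℝ) - 1) - ε) * n ≤ coPosEx n 𝓕 := by
  obtain ⟨M, -, hM⟩ := Finset.exists_subset_card_eq
    (show 3 ≤ (Finset.univ : Finset (Fin (r + 1))).card by simp; omega)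
  have hMne : M.Nonempty := Finset.card_pos.1 (by omega)
  have hsum : ∑ u : Fin (r + 1), (if u ∈ M then 1 else 2) = 2 * r - 1 := by
    have h1 : ∑ u : Fin (r + 1), ((if u ∈ M then 1 else 2) + if u ∈ M then 1 else 0) =
        ∑ u : Fin (r + 1), 2 := Finset.sum_congr rfl fun u _ => by split_ifs <;> rfl
    rw [Finset.sum_add_distrib] at h1
    simp [hM] at h1
    omega
  have := eventually_le_coPosEx (G := missing r M) (d := 2) (w := fun u => if u ∈ M then 1 else 2)
    (by omega) (hMne.image _) (fun F h => hF F h _ (isTriangle_missing hM))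
    (fun u => by split_ifs <;> norm_num)
    (fun S hS he => two_le_sum_nbr_missing (by omega) hS he) hsum hε
  have hcast : ((2 * r - 1 : ℕ) : ℝ) = 2 * (r : ℝ) - 1 := by
    rw [Nat.cast_sub (by omega)]; push_cast; ring
  rw [hcast] at this
  exact_mod_cast this

end LowerBounds

end RGraph

/-! ### A Chernoff bound for random maps -/

section Concentration

/-- Follows from `exp x ≥ 1 + x + x²/2`, because `(1 + x + x²/2)(1 - x + x²/2) = 1 + x⁴/4 ≥ 1`. -/
theorem exp_neg_le_quadratic {x : ℝ} (hx : 0 ≤ x) : Real.exp (-x) ≤ 1 - x + x ^ 2 / 2 := by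
  rw [Real.exp_neg, inv_le_comm₀ (Real.exp_pos _) (by nlinarith [sq_nonneg (x - 1)])]
  refine le_trans ?_ (Real.quadratic_le_exp_of_nonneg hx)
  rw [inv_le_iff_one_le_mul₀ (by nlinarith [sq_nonneg (x - 1)])]
  nlinarith [sq_nonneg (x ^ 2)]

/-- Chernoff's bound in counting form: few maps `ι → Fin n` hit the set `A` much less often than
expected. -/
theorem card_few_hits_le {ι : Type*} [Fintype ι] [DecidableEq ι] {n : ℕ} (A : Finset (Fin n))
    {α ε : ℝ} (hα0 : 0 ≤ α) (hα1 : α ≤ 1) (hε : 0 < ε) (hA : α * n ≤ A.card) :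
    ((Finset.univ.filter (fun f : ι → Fin n =>
      ((Finset.univ.filter (fun i => f i ∈ A)).card : ℝ) ≤ (α - ε) * Fintype.card ι)).card : ℝ) ≤
      Real.exp (-(ε ^ 2 / 2)) ^ Fintype.card ι * (n : ℝ) ^ Fintype.card ι := by
  set k := Fintype.card ι with hk
  set B := Finset.univ.filter (fun f : ι → Fin n =>
      ((Finset.univ.filter (fun i => f i ∈ A)).card : ℝ) ≤ (α - ε) * k) with hB
  -- Exponential moment method with parameter `ε`: maps with few hits have a large product of
  -- weights, while the sum of these products over all maps factorises.
  set w : Fin n → ℝ := fun v => if v ∈ A then Real.exp (-ε) else 1 with hw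
  have hw0 : ∀ v, 0 < w v := fun v => by
    simp only [hw]; split_ifs
    · exact Real.exp_pos _
    · norm_num
  have hprod : ∀ f : ι → Fin n,
      ∏ i, w (f i) = Real.exp (-ε) ^ (Finset.univ.filter (fun i => f i ∈ A)).card := fun f => by
    simp only [hw]
    rw [Finset.prod_ite, Finset.prod_const, Finset.prod_const_one, mul_one]
  have htotal : ∑ f : ι → Fin n, ∏ i, w (f i) = (∑ v, w v) ^ k := by
    have := Finset.prod_univ_sum (fun _ : ι => (Finset.univ : Finset (Fin n))) (fun _ v => w v)
    rw [Finset.prod_const, Finset.card_univ, Fintype.piFinset_univ] at this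
    exact this.symm
  have hsum : ∑ v, w v ≤ n * Real.exp (-α * (ε - ε ^ 2 / 2)) := by
    have h1 : ∑ v, w v = n - A.card * (1 - Real.exp (-ε)) := by
      have h2 : ∀ v, w v = 1 - if v ∈ A then 1 - Real.exp (-ε) else 0 := fun v => by
        simp only [hw]; split_ifs <;> ring
      rw [Finset.sum_congr rfl fun v _ => h2 v, Finset.sum_sub_distrib]
      simp
      ring
    have h3 : 0 ≤ 1 - Real.exp (-ε) := by
      have := Real.exp_le_one_iff.2 (by linarith : -ε ≤ 0); linarith
    have h4 := mul_le_mul_of_nonneg_right hA h3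
    have h5 : (ε - ε ^ 2 / 2) * (α * n) ≤ (1 - Real.exp (-ε)) * (α * n) :=
      mul_le_mul_of_nonneg_right (by have := exp_neg_le_quadratic hε.le; linarith) (by positivity)
    have h6 := mul_le_mul_of_nonneg_left (Real.add_one_le_exp (-α * (ε - ε ^ 2 / 2)))
      (Nat.cast_nonneg (α := ℝ) n)
    rw [h1]
    linarith
  have hlow : B.card * Real.exp (-ε * ((α - ε) * k)) ≤ (∑ v, w v) ^ k := by
    rw [← htotal, ← nsmul_eq_mul]
    refine (Finset.card_nsmul_le_sum B (fun f => ∏ i, w (f i)) _ fun f hf => ?_).trans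
      (Finset.sum_le_sum_of_subset_of_nonneg (Finset.subset_univ _)
        fun f _ _ => Finset.prod_nonneg fun i _ => (hw0 _).le)
    rw [hprod, ← Real.exp_nat_mul]
    refine Real.exp_le_exp.2 ?_
    have := mul_le_mul_of_nonneg_left (Finset.mem_filter.1 hf).2 hε.le
    linarith
  have hup : (∑ v, w v) ^ k ≤ (n * Real.exp (-α * (ε - ε ^ 2 / 2))) ^ k :=
    pow_le_pow_left₀ (Finset.sum_nonneg fun v _ => (hw0 v).le) hsum _
  have hexp : Real.exp (-α * (ε - ε ^ 2 / 2)) ^ k ≤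
      Real.exp (-(ε ^ 2 / 2)) ^ k * Real.exp (-ε * ((α - ε) * k)) := by
    rw [← Real.exp_nat_mul, ← Real.exp_nat_mul, ← Real.exp_add]
    refine Real.exp_le_exp.2 ?_
    -- The difference of the two sides is `(1 - α) * ε ^ 2 / 2`; this is where `α ≤ 1` enters.
    have h1 : -α * (ε - ε ^ 2 / 2) ≤ -(ε ^ 2 / 2) + -ε * (α - ε) := by
      nlinarith [sq_nonneg ε]
    have := mul_le_mul_of_nonneg_left h1 (Nat.cast_nonneg (α := ℝ) k)
    linarith
  have hfinal : B.card * Real.exp (-ε * ((α - ε) * k)) ≤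
      Real.exp (-(ε ^ 2 / 2)) ^ k * (n : ℝ) ^ k * Real.exp (-ε * ((α - ε) * k)) := by
    refine (hlow.trans hup).trans ?_
    rw [mul_pow]
    have := mul_le_mul_of_nonneg_left hexp (show (0 : ℝ) ≤ (n : ℝ) ^ k by positivity)
    linarith
  exact le_of_mul_le_mul_right hfinal (Real.exp_pos _)

end Concentration

namespace RGraph

/-! ### Random samples preserve the relative positive co-degree -/

section Sampling

variable {r n : ℕ}

/-- The maps `f` for which the image of `S` is an `(r-1)`-set contained in an edge of `H`, with at
most `b` indices mapped into its neighbourhood. -/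
noncomputable def lowDegreeMaps {m : ℕ} (H : RGraph r (Fin n)) (S : Finset (Fin m)) (b : ℝ) :
    Finset (Fin m → Fin n) :=
  Finset.univ.filter (fun f => (S.image f).card = r - 1 ∧ (∃ e ∈ H.edges, S.image f ⊆ e) ∧
    ((Finset.univ.filter (fun i => f i ∈ H.nbr (S.image f))).card : ℝ) ≤ b)

/-- Once `f` is fixed on `S`, the target neighbourhood is determined and the other `m - (r - 1)`
values are free, so the Chernoff bound applies in each fibre of the restriction to `S`. -/
theorem HasPosCodegree.card_lowDegreeMaps_le {H : RGraph r (Fin n)} {d m : ℕ}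
    (h : H.HasPosCodegree d) {S : Finset (Fin m)} (hS : S.card = r - 1) {α ε : ℝ} (hα0 : 0 ≤ α)
    (hα1 : α ≤ 1) (hε : 0 < ε) (hd : α * n ≤ d) :
    ((H.lowDegreeMaps S ((α - ε) * (m - (r - 1) : ℕ))).card : ℝ) ≤
      Real.exp (-(ε ^ 2 / 2)) ^ (m - (r - 1)) * (n : ℝ) ^ m := by
  set k := m - (r - 1) with hk
  set q := Real.exp (-(ε ^ 2 / 2)) with hq
  have hSm : r - 1 ≤ m := by
    rw [← hS]; simpa using Finset.card_le_univ S
  have hcard : Fintype.card {i // i ∉ S} = k := by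
    rw [Fintype.card_subtype_compl, Fintype.card_coe, Fintype.card_fin, hS]
  set B := H.lowDegreeMaps S ((α - ε) * k) with hB
  have hfib : ∀ g : {i // i ∈ S} → Fin n,
      ((B.filter (fun f => (fun i : {i // i ∈ S} => f i) = g)).card : ℝ) ≤ q ^ k * (n : ℝ) ^ k := by
    intro g
    have himg : ∀ f : Fin m → Fin n, (fun i : {i // i ∈ S} => f i) = g →
        S.image f = Finset.univ.image g := by
      rintro f rfl
      ext v
      simp
    by_cases hg : (Finset.univ.image g).card = r - 1 ∧ ∃ e ∈ H.edges, Finset.univ.image g ⊆ e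
    · have hA := h.2 _ hg.1 hg.2
      have hc := card_few_hits_le (ι := {i // i ∉ S}) (H.nbr (Finset.univ.image g)) hα0 hα1 hε
        (hd.trans (by exact_mod_cast hA))
      rw [hcard] at hc
      refine le_trans ?_ hc
      norm_cast
      refine Finset.card_le_card_of_injOn (fun f i => f i) ?_ ?_
      · intro f hf
        obtain ⟨hf, hfg⟩ := Finset.mem_filter.1 (Finset.mem_coe.1 hf)
        obtain ⟨-, -, -, hf⟩ := Finset.mem_filter.1 hf
        refine Finset.mem_coe.2 (Finset.mem_filter.2 ⟨Finset.mem_univ _, le_trans ?_ hf⟩)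
        rw [himg f hfg]
        norm_cast
        refine Finset.card_le_card_of_injOn Subtype.val ?_ Subtype.val_injective.injOn
        intro i hi
        exact Finset.mem_coe.2 (Finset.mem_filter.2 ⟨Finset.mem_univ _,
          (Finset.mem_filter.1 (Finset.mem_coe.1 hi)).2⟩)
      · intro f hf f' hf' heq
        have hfg := (Finset.mem_filter.1 (Finset.mem_coe.1 hf)).2
        have hfg' := (Finset.mem_filter.1 (Finset.mem_coe.1 hf')).2
        funext i
        by_cases hi : i ∈ S
        · exact congrFun (hfg.trans hfg'.symm) ⟨i, hi⟩
        · exact congrFun heq ⟨i, hi⟩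
    · rw [Finset.card_eq_zero.2, Nat.cast_zero]
      · positivity
      · refine Finset.filter_eq_empty_iff.2 fun f hf hfg => hg ?_
        obtain ⟨-, h1, h2, -⟩ := Finset.mem_filter.1 hf
        rw [himg f hfg] at h1 h2
        exact ⟨h1, h2⟩
  rw [Finset.card_eq_sum_card_fiberwise (f := fun f (i : {i // i ∈ S}) => f i)
    (t := Finset.univ) (by simp)]
  push_cast
  refine (Finset.sum_le_card_nsmul _ _ _ fun g _ => hfib g).trans (le_of_eq ?_)
  rw [Finset.card_univ, Fintype.card_fun, Fintype.card_fin, Fintype.card_coe, hS, nsmul_eq_mul]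
  push_cast
  rw [show m = (r - 1) + k by omega, pow_add]
  ring

/-- The maps that send the first `r` indices onto an edge of `H`. -/
def edgeMaps (H : RGraph r (Fin n)) (k : ℕ) : Finset (Fin (r + k) → Fin n) :=
  Finset.univ.filter (fun f => Finset.univ.image (fun i => f (Fin.castAdd k i)) ∈ H.edges)

theorem HasPosCodegree.card_edgeMaps_ge {H : RGraph r (Fin n)} {d : ℕ} (h : H.HasPosCodegree d)
    (k : ℕ) : d ^ r * n ^ k ≤ (H.edgeMaps k).card := by
  calc d ^ r * n ^ k
      ≤ (((singleEdge r).copies H) ×ˢ (Finset.univ : Finset (Fin k → Fin n))).card := by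
        rw [Finset.card_product, Finset.card_univ, Fintype.card_fun, Fintype.card_fin,
          Fintype.card_fin]
        exact Nat.mul_le_mul_right _ h.pow_le_card_copies
    _ ≤ _ := by
        refine Finset.card_le_card_of_injOn (fun p => Fin.append p.1 p.2) ?_ ?_
        · rintro ⟨y, z⟩ hp
          have := mem_copies_singleEdge.1 (Finset.mem_product.1 (Finset.mem_coe.1 hp)).1
          simpa [edgeMaps] using this
        · rintro ⟨y, z⟩ - ⟨y', z'⟩ - heq
          have hy : y = y' := funext fun i => by
            simpa using congrFun heq (Fin.castAdd k i)
          have hz : z = z' := funext fun i => by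
            simpa using congrFun heq (Fin.natAdd r i)
          rw [hy, hz]

/-- Sampling: a large `H` has an induced subhypergraph on `r + k` vertices of almost the same
relative minimum positive co-degree. -/
theorem HasPosCodegree.exists_sample (hr : 1 ≤ r) {H : RGraph r (Fin n)} {d k : ℕ}
    (h : H.HasPosCodegree d) (hn : 0 < n) (hkn : r + k ≤ n) {ε : ℝ} (hε : 0 < ε)
    (hd : ε * n < d) (hdn : d ≤ n)
    (hk : ((r + k : ℕ) : ℝ) ^ (r - 1) * Real.exp (-(ε ^ 2 / 2)) ^ (r + k - (r - 1)) < ε ^ r / 2)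
    (hkn' : ((r + k : ℕ) : ℝ) ^ 2 / n < ε ^ r / 2) :
    ∃ f : Fin (r + k) ↪ Fin n, (H.comap f).HasPosCodegree
      ⌈((d : ℝ) / n - ε) * (r + k - (r - 1) : ℕ)⌉₊ := by
  have hn' : (0 : ℝ) < n := by exact_mod_cast hn
  set α : ℝ := (d : ℝ) / n with hα
  set q := Real.exp (-(ε ^ 2 / 2)) with hq
  have hα0 : 0 ≤ α := by positivity
  have hα1 : α ≤ 1 := (div_le_one hn').2 (by exact_mod_cast hdn)
  have hαd : α * n = d := div_mul_cancel₀ _ hn'.ne'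
  set b : ℝ := (α - ε) * (r + k - (r - 1) : ℕ) with hb
  -- Union bound: more than a proportion `ε ^ r` of the maps put an edge on the first `r` indices,
  -- which keeps the sample from being edgeless. Non-injective maps and maps of low degree at some
  -- `S` each account for less than `ε ^ r / 2`.
  have hgood : ∃ f ∈ H.edgeMaps k, Function.Injective f ∧
      ∀ S ∈ (Finset.univ : Finset (Fin (r + k))).powersetCard (r - 1),
        f ∉ H.lowDegreeMaps S b := by
    by_contra! hcon
    have hsub : H.edgeMaps k ⊆ (Finset.univ.filter (fun f => ¬ Function.Injective f)) ∪
        ((Finset.univ : Finset (Fin (r + k))).powersetCard (r - 1)).biUnion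
          (fun S => H.lowDegreeMaps S b) := by
      intro f hf
      rw [Finset.mem_union, Finset.mem_biUnion]
      by_cases hinj : Function.Injective f
      · exact Or.inr (hcon f hf hinj)
      · exact Or.inl (Finset.mem_filter.2 ⟨Finset.mem_univ _, hinj⟩)
    have h1 : ((H.edgeMaps k).card : ℝ) ≤
        (Finset.univ.filter (fun f : Fin (r + k) → Fin n => ¬ Function.Injective f)).card +
        ∑ S ∈ (Finset.univ : Finset (Fin (r + k))).powersetCard (r - 1),
          ((H.lowDegreeMaps S b).card : ℝ) := by
      exact_mod_cast (Finset.card_le_card hsub).trans ((Finset.card_union_le _ _).trans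
        (Nat.add_le_add_left Finset.card_biUnion_le _))
    have h2 : ∑ S ∈ (Finset.univ : Finset (Fin (r + k))).powersetCard (r - 1),
          ((H.lowDegreeMaps S b).card : ℝ) ≤
        ((r + k : ℕ) : ℝ) ^ (r - 1) * (q ^ (r + k - (r - 1)) * (n : ℝ) ^ (r + k)) := by
      refine (Finset.sum_le_card_nsmul _ _ (q ^ (r + k - (r - 1)) * (n : ℝ) ^ (r + k))
        fun S hS => h.card_lowDegreeMaps_le (Finset.mem_powersetCard.1 hS).2 hα0 hα1 hε
          hαd.le).trans ?_
      rw [nsmul_eq_mul, Finset.card_powersetCard, Finset.card_univ, Fintype.card_fin]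
      refine mul_le_mul_of_nonneg_right ?_ (by positivity)
      exact_mod_cast Nat.choose_le_pow (r + k) (r - 1)
    have h3 : ε ^ r * (n : ℝ) ^ (r + k) ≤ (H.edgeMaps k).card := by
      have h4 : (d : ℝ) ^ r * (n : ℝ) ^ k ≤ (H.edgeMaps k).card := by
        exact_mod_cast h.card_edgeMaps_ge k
      refine le_trans ?_ h4
      rw [pow_add, ← mul_assoc, ← mul_pow]
      exact mul_le_mul_of_nonneg_right (pow_le_pow_left₀ (by positivity) hd.le _) (by positivity)
    have h5 := card_not_injective_le hn hkn
    have hpos : (0 : ℝ) < (n : ℝ) ^ (r + k) := by positivity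
    have h6 := mul_lt_mul_of_pos_right hk hpos
    have h7 := mul_lt_mul_of_pos_right hkn' hpos
    linarith
  obtain ⟨f, hfE, hinj, hf⟩ := hgood
  refine ⟨⟨f, hinj⟩, hasPosCodegree_comap hr
    ⟨Finset.univ.image (Fin.castAdd k), mem_comap_edges.2 ⟨?_, ?_⟩⟩ fun S hS hS' he => ?_⟩
  · rw [Finset.card_image_of_injective _ (Fin.castAdd_injective r k), Finset.card_univ,
      Fintype.card_fin]
  · rw [Finset.image_image]
    exact (Finset.mem_filter.1 hfE).2
  · have := hf S (Finset.mem_powersetCard.2 ⟨Finset.subset_univ _, hS⟩)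
    refine Nat.ceil_le.2 (le_of_not_ge fun hle => this ?_)
    exact Finset.mem_filter.2 ⟨Finset.mem_univ _, hS', he, hle⟩

end Sampling

end RGraph

/-! ### Existence of the limit -/

section Limit

/-- For large `m` the upper limit is at most `a m + ε`; taking the lower limit in `m` shows that the
two limits agree. -/
theorem exists_tendsto_of_eventually_le_add {a : ℕ → ℝ} (h0 : ∀ n, 0 ≤ a n) (h1 : ∀ n, a n ≤ 1)
    (h : ∀ ε > 0, ∀ᶠ m in atTop, ∀ᶠ n in atTop, a n ≤ a m + ε) :
    ∃ L, Tendsto a atTop (𝓝 L) := by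
  have hbb : IsBoundedUnder (· ≤ ·) atTop a := isBoundedUnder_of ⟨1, h1⟩
  have hbb' : IsBoundedUnder (· ≥ ·) atTop a := isBoundedUnder_of ⟨0, h0⟩
  refine ⟨limsup a atTop, tendsto_of_le_liminf_of_limsup_le ?_ le_rfl hbb hbb'⟩
  refine le_of_forall_pos_le_add fun ε hε => ?_
  rw [← sub_le_iff_le_add]
  refine le_liminf_of_le hbb.isCoboundedUnder_ge ?_
  filter_upwards [h ε hε] with m hm
  rw [sub_le_iff_le_add]
  exact limsup_le_of_le hbb'.isCoboundedUnder_le hm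

variable {r : ℕ}

theorem coPosEx_div_le_one (hr : 1 ≤ r) (𝓕 : RGraphFamily r) (n : ℕ) :
    (coPosEx n 𝓕 : ℝ) / n ≤ 1 :=
  div_le_one_of_le₀ (by exact_mod_cast coPosEx_le hr) (Nat.cast_nonneg _)

theorem eventually_sample_bound (r : ℕ) {ε : ℝ} (hε : 0 < ε) :
    ∀ᶠ m : ℕ in atTop,
      (m : ℝ) ^ (r - 1) * Real.exp (-(ε ^ 2 / 2)) ^ (m - (r - 1)) < ε ^ r / 2 := by
  set q := Real.exp (-(ε ^ 2 / 2)) with hq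
  have hq0 : 0 < q := Real.exp_pos _
  have hq1 : q < 1 := Real.exp_lt_one_iff.2 (neg_lt_zero.2 (by positivity))
  have h := tendsto_pow_const_mul_const_pow_of_abs_lt_one (r - 1) (r := q)
    (by rwa [abs_of_pos hq0])
  filter_upwards [h.eventually_lt_const (show 0 < ε ^ r / 2 * q ^ (r - 1) by positivity),
    eventually_ge_atTop (r - 1)] with m hm hmr
  refine lt_of_mul_lt_mul_right (lt_of_eq_of_lt ?_ hm) (show 0 ≤ q ^ (r - 1) by positivity)
  rw [mul_assoc, ← pow_add, Nat.sub_add_cancel hmr]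

/-- An induced sample of an extremal graph is still free. One `ε` pays for the sampling deviation,
the other for the `r - 1` sampled indices occupied by `S`, a proportion below `ε` when `m > r / ε`.
-/
theorem eventually_coPosEx_div_le_add (hr : 1 ≤ r) (𝓕 : RGraphFamily r) {ε : ℝ} (hε : 0 < ε) :
    ∀ᶠ m : ℕ in atTop, ∀ᶠ n : ℕ in atTop,
      (coPosEx n 𝓕 : ℝ) / n ≤ (coPosEx m 𝓕 : ℝ) / m + 2 * ε := by
  obtain ⟨m₀, hm₀⟩ := exists_nat_gt ((r : ℝ) / ε)
  filter_upwards [eventually_sample_bound r hε, eventually_ge_atTop r, eventually_ge_atTop m₀]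
    with m hm hmr hm₀m
  obtain ⟨k, rfl⟩ := Nat.exists_eq_add_of_le hmr
  obtain ⟨n₀, hn₀⟩ := exists_nat_gt (((r + k : ℕ) : ℝ) ^ 2 / (ε ^ r / 2))
  filter_upwards [eventually_ge_atTop n₀, eventually_ge_atTop (r + k)] with n hn hkn
  have hn0 : 0 < n := by omega
  have hn' : (0 : ℝ) < n := by exact_mod_cast hn0
  have hm' : (0 : ℝ) < ((r + k : ℕ) : ℝ) := by exact_mod_cast (by omega : 0 < r + k)
  have ham : 0 ≤ (coPosEx (r + k) 𝓕 : ℝ) / ((r + k : ℕ) : ℝ) := by positivity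
  -- Below density `ε` there is nothing to prove; above it, edges are dense enough for sampling.
  by_cases hsmall : (coPosEx n 𝓕 : ℝ) ≤ ε * n
  · have : (coPosEx n 𝓕 : ℝ) / n ≤ ε := (div_le_iff₀ hn').2 hsmall
    linarith
  push Not at hsmall
  have hpos : 0 < coPosEx n 𝓕 := by
    have : (0 : ℝ) < coPosEx n 𝓕 := lt_of_le_of_lt (by positivity) hsmall
    exact_mod_cast this
  obtain ⟨H, hfree, hH⟩ := exists_free_of_coPosEx_pos hr hpos
  have hkn' : ((r + k : ℕ) : ℝ) ^ 2 / n < ε ^ r / 2 := by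
    rw [div_lt_iff₀ (by positivity)] at hn₀
    rw [div_lt_iff₀ hn']
    have : (n₀ : ℝ) ≤ n := by exact_mod_cast hn
    have := mul_le_mul_of_nonneg_right this (show 0 ≤ ε ^ r / 2 by positivity)
    linarith
  obtain ⟨f, hf⟩ := hH.exists_sample hr hn0 hkn hε hsmall (coPosEx_le hr) hm hkn'
  have hle := le_coPosEx hr
    (fun F hF hcon => hfree F hF (isContainedIn_of_isContainedIn_comap hcon)) hf
  set α : ℝ := (coPosEx n 𝓕 : ℝ) / n with hα
  have hα1 : α ≤ 1 := coPosEx_div_le_one hr 𝓕 n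
  have h1 : (α - ε) * (r + k - (r - 1) : ℕ) ≤ coPosEx (r + k) 𝓕 :=
    (Nat.le_ceil _).trans (by exact_mod_cast hle)
  have h2 : ((r + k - (r - 1) : ℕ) : ℝ) = ((r + k : ℕ) : ℝ) - ((r - 1 : ℕ) : ℝ) :=
    Nat.cast_sub (by omega)
  have h3 : ((r - 1 : ℕ) : ℝ) ≤ ε * ((r + k : ℕ) : ℝ) := by
    rw [div_lt_iff₀ hε] at hm₀
    have h4 : ((r - 1 : ℕ) : ℝ) ≤ r := by exact_mod_cast Nat.sub_le r 1
    have h5 : (m₀ : ℝ) ≤ ((r + k : ℕ) : ℝ) := by exact_mod_cast hm₀m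
    nlinarith
  have h6 : (α - ε) * ((r - 1 : ℕ) : ℝ) ≤ ((r - 1 : ℕ) : ℝ) := by
    have : (0 : ℝ) ≤ ((r - 1 : ℕ) : ℝ) := Nat.cast_nonneg _
    nlinarith
  rw [h2, mul_sub] at h1
  rw [← sub_le_iff_le_add, le_div_iff₀ hm']
  nlinarith

theorem exists_tendsto_coPosEx (hr : 1 ≤ r) (𝓕 : RGraphFamily r) :
    ∃ L, Tendsto (fun n : ℕ => (coPosEx n 𝓕 : ℝ) / n) atTop (𝓝 L) := by
  refine exists_tendsto_of_eventually_le_add (fun n => by positivity) (coPosEx_div_le_one hr 𝓕) ?_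
  intro ε hε
  have := eventually_coPosEx_div_le_add hr 𝓕 (half_pos hε)
  simpa [mul_div_cancel₀] using this

end Limit

/-! ### The values of the density and the jumps -/

section Main

variable {r : ℕ}

theorem tendsto_posCodegreeDensity (hr : 1 ≤ r) (𝓕 : RGraphFamily r) :
    Tendsto (fun n : ℕ => (coPosEx n 𝓕 : ℝ) / (n : ℝ)) atTop (𝓝 (posCodegreeDensity 𝓕)) :=
  tendsto_nhds_limUnder (exists_tendsto_coPosEx hr 𝓕)

theorem posCodegreeDensity_nonneg (hr : 1 ≤ r) (𝓕 : RGraphFamily r) :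
    0 ≤ posCodegreeDensity 𝓕 :=
  ge_of_tendsto' (tendsto_posCodegreeDensity hr 𝓕) fun n => by positivity

theorem posCodegreeDensity_le_one (hr : 1 ≤ r) (𝓕 : RGraphFamily r) :
    posCodegreeDensity 𝓕 ≤ 1 :=
  le_of_tendsto' (tendsto_posCodegreeDensity hr 𝓕) (coPosEx_div_le_one hr 𝓕)

theorem posCodegreeDensity_le_of_eventually (hr : 1 ≤ r) {𝓕 : RGraphFamily r} {a : ℝ}
    (h : ∀ ε : ℝ, 0 < ε → ∀ᶠ n : ℕ in atTop, (coPosEx n 𝓕 : ℝ) ≤ (a + ε) * n) :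
    posCodegreeDensity 𝓕 ≤ a := by
  refine le_of_forall_pos_le_add fun ε hε => le_of_tendsto (tendsto_posCodegreeDensity hr 𝓕) ?_
  filter_upwards [h ε hε, eventually_gt_atTop 0] with n hn h0
  exact (div_le_iff₀ (by exact_mod_cast h0)).2 hn

theorem le_posCodegreeDensity_of_eventually (hr : 1 ≤ r) {𝓕 : RGraphFamily r} {a : ℝ}
    (h : ∀ ε : ℝ, 0 < ε → ∀ᶠ n : ℕ in atTop, (a - ε) * n ≤ (coPosEx n 𝓕 : ℝ)) :
    a ≤ posCodegreeDensity 𝓕 := by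
  refine le_of_forall_pos_le_add fun ε hε => sub_le_iff_le_add.1 ?_
  refine ge_of_tendsto (tendsto_posCodegreeDensity hr 𝓕) ?_
  filter_upwards [h ε hε, eventually_gt_atTop 0] with n hn h0
  exact (le_div_iff₀ (by exact_mod_cast h0)).2 hn

theorem posCodegreeDensity_eq_zero (hr : 1 ≤ r) {𝓕 : RGraphFamily r}
    (h : ∃ F ∈ 𝓕, F.2.IsPartite r) : posCodegreeDensity 𝓕 = 0 := by
  obtain ⟨F, hF, hP⟩ := h
  refine le_antisymm (posCodegreeDensity_le_of_eventually hr fun ε hε => ?_)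
    (posCodegreeDensity_nonneg hr 𝓕)
  simpa using eventually_coPosEx_le_of_isPartite hr hF hP hε

theorem one_div_le_posCodegreeDensity (hr : 1 ≤ r) {𝓕 : RGraphFamily r}
    (h : ∀ F ∈ 𝓕, ¬ F.2.IsPartite r) : 1 / (r : ℝ) ≤ posCodegreeDensity 𝓕 :=
  le_posCodegreeDensity_of_eventually hr fun _ hε => eventually_le_coPosEx_of_not_isPartite hr h hε

theorem posCodegreeDensity_eq_one_div (hr : 2 ≤ r) {𝓕 : RGraphFamily r}
    (h : ∀ F ∈ 𝓕, ¬ F.2.IsPartite r)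
    (h' : ∃ F ∈ 𝓕, ∃ T : RGraph r (Fin (r + 1)), T.IsTriangle ∧
      ∃ t : ℕ, F.2.IsContainedIn (T.blowUp t)) : posCodegreeDensity 𝓕 = 1 / (r : ℝ) := by
  obtain ⟨F, hF, T, hT, t, hFT⟩ := h'
  exact le_antisymm (posCodegreeDensity_le_of_eventually (by omega) fun ε hε =>
      eventually_coPosEx_le_of_homTo_triangle hr hF hT (homTo_of_isContainedIn_blowUp hFT) hε)
    (one_div_le_posCodegreeDensity (by omega) h)

theorem two_div_le_posCodegreeDensity (hr : 2 ≤ r) {𝓕 : RGraphFamily r}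
    (h : ¬ ∃ F ∈ 𝓕, ∃ T : RGraph r (Fin (r + 1)), T.IsTriangle ∧
      ∃ t : ℕ, F.2.IsContainedIn (T.blowUp t)) :
    2 / (2 * (r : ℝ) - 1) ≤ posCodegreeDensity 𝓕 :=
  le_posCodegreeDensity_of_eventually (by omega) fun _ hε =>
    eventually_le_coPosEx_of_not_homTo_triangle hr
      (fun F hF T hT hFT => h ⟨F, hF, T, hT, _, hFT.isContainedIn_blowUp⟩) hε

theorem one_div_lt_two_div {r : ℝ} (hr : 2 ≤ r) : 1 / r < 2 / (2 * r - 1) := by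
  rw [div_lt_div_iff₀ (by linarith) (by linarith)]
  linarith

theorem posCodegreeDensity_trichotomy (hr : 2 ≤ r) (𝓕 : RGraphFamily r) :
    posCodegreeDensity 𝓕 ∈ ({0, 1 / (r : ℝ)} : Set ℝ) ∪ Set.Icc (2 / (2 * (r : ℝ) - 1)) 1 := by
  by_cases hP : ∃ F ∈ 𝓕, F.2.IsPartite r
  · exact Or.inl (Or.inl (posCodegreeDensity_eq_zero (by omega) hP))
  by_cases hT : ∃ F ∈ 𝓕, ∃ T : RGraph r (Fin (r + 1)), T.IsTriangle ∧
      ∃ t : ℕ, F.2.IsContainedIn (T.blowUp t)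
  · exact Or.inl (Or.inr (posCodegreeDensity_eq_one_div hr (fun F hF h => hP ⟨F, hF, h⟩) hT))
  · exact Or.inr ⟨two_div_le_posCodegreeDensity hr hT, posCodegreeDensity_le_one (by omega) 𝓕⟩

theorem posCodegreeDensity_eq_zero_iff (hr : 1 ≤ r) (𝓕 : RGraphFamily r) :
    posCodegreeDensity 𝓕 = 0 ↔ ∃ F ∈ 𝓕, F.2.IsPartite r := by
  refine ⟨fun h => ?_, posCodegreeDensity_eq_zero hr⟩
  by_contra hP
  have h1 := one_div_le_posCodegreeDensity hr fun F hF h => hP ⟨F, hF, h⟩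
  have h2 : (0 : ℝ) < 1 / r := one_div_pos.2 (by exact_mod_cast hr)
  linarith

theorem posCodegreeDensity_eq_one_div_iff (hr : 2 ≤ r) (𝓕 : RGraphFamily r) :
    posCodegreeDensity 𝓕 = 1 / (r : ℝ) ↔
      (∀ F ∈ 𝓕, ¬ F.2.IsPartite r) ∧
      ∃ F ∈ 𝓕, ∃ T : RGraph r (Fin (r + 1)), T.IsTriangle ∧
        ∃ t : ℕ, F.2.IsContainedIn (T.blowUp t) := by
  refine ⟨fun h => ⟨fun F hF hP => ?_, ?_⟩, fun h => posCodegreeDensity_eq_one_div hr h.1 h.2⟩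
  · rw [posCodegreeDensity_eq_zero (by omega) ⟨F, hF, hP⟩] at h
    have h2 : (0 : ℝ) < 1 / r := one_div_pos.2 (by exact_mod_cast (by omega : 0 < r))
    linarith
  · by_contra hT
    have h1 := two_div_le_posCodegreeDensity hr hT
    have h2 := one_div_lt_two_div (r := r) (by exact_mod_cast hr)
    linarith

/-- Take `δ` to be the distance from `α` to the next admissible value, `1/r` or `2/(2r - 1)`; the
interval is open, so that value itself is excluded. -/
theorem isJump_posCodegreeDensity (hr : 2 ≤ r) {α : ℝ}
    (hα : α ∈ Set.Ico (0 : ℝ) (2 / (2 * (r : ℝ) - 1))) :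
    IsJump (fun 𝓕 : RGraphFamily r => posCodegreeDensity 𝓕) α := by
  have hr' : (2 : ℝ) ≤ r := by exact_mod_cast hr
  have h1 := one_div_lt_two_div hr'
  have h2 : 2 / (2 * (r : ℝ) - 1) < 1 := by
    rw [div_lt_one (by linarith)]; linarith
  obtain ⟨h0, hα⟩ := hα
  have hpos : (0 : ℝ) < 1 / r := by positivity
  refine ⟨⟨h0, hα.trans h2⟩, ?_⟩
  by_cases hαr : α < 1 / (r : ℝ)
  · refine ⟨1 / r - α, ⟨by linarith, by linarith⟩, ?_⟩
    rintro ⟨𝓕, hl, hu⟩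
    simp only [add_sub_cancel] at hl hu
    rcases posCodegreeDensity_trichotomy hr 𝓕 with (h | h) | h
    · rw [h] at hl; linarith
    · rw [h] at hu; exact lt_irrefl _ hu
    · linarith [h.1]
  · push Not at hαr
    refine ⟨2 / (2 * (r : ℝ) - 1) - α, ⟨by linarith, by linarith⟩, ?_⟩
    rintro ⟨𝓕, hl, hu⟩
    simp only [add_sub_cancel] at hl hu
    rcases posCodegreeDensity_trichotomy hr 𝓕 with (h | h) | h
    · rw [h] at hl; linarith
    · rw [h] at hl; exact lt_irrefl _ (hl.trans_le hαr)
    · linarith [h.1]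

end Main

theorem theorem2p1 (r : ℕ) (hr : 2 ≤ r) :
    (∀ 𝓕 : RGraphFamily r,
      Tendsto (fun n : ℕ => (coPosEx n 𝓕 : ℝ) / (n : ℝ)) atTop (𝓝 (posCodegreeDensity 𝓕)) ∧
      posCodegreeDensity 𝓕 ∈
        ({0, 1 / (r : ℝ)} : Set ℝ) ∪ Set.Icc (2 / (2 * (r : ℝ) - 1)) 1 ∧
      (posCodegreeDensity 𝓕 = 0 ↔ ∃ F ∈ 𝓕, F.2.IsPartite r) ∧
      (posCodegreeDensity 𝓕 = 1 / (r : ℝ) ↔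
        (∀ F ∈ 𝓕, ¬ F.2.IsPartite r) ∧
        ∃ F ∈ 𝓕, ∃ T : RGraph r (Fin (r + 1)), T.IsTriangle ∧
          ∃ t : ℕ, F.2.IsContainedIn (T.blowUp t))) ∧
    (∀ α ∈ Set.Ico (0 : ℝ) (2 / (2 * (r : ℝ) - 1)),
      IsJump (fun 𝓕 : RGraphFamily r => posCodegreeDensity 𝓕) α) :=
  ⟨fun 𝓕 => ⟨tendsto_posCodegreeDensity (by omega) 𝓕, posCodegreeDensity_trichotomy hr 𝓕,
    posCodegreeDensity_eq_zero_iff (by omega) 𝓕, posCodegreeDensity_eq_one_div_iff hr 𝓕⟩,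
    fun _ hα => isJump_posCodegreeDensity hr hα⟩
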